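/- Fix a dimension $d$ and a terminal time $T>0$. For a Borel probability measure $p$ on $\mathbb R^d$ and $t>0$ let $p_t=p*\mathcal N(0,t^2I)$ be the law at time $t$ of the forward process $x_t=x_0+\int_0^t\sqrt{2\tau}\,\mathrm dw_\tau$, $x_0\sim p$ (independent of the Wiener process $w$); write $p_t$ also for its smooth positive density. A trajectory of the EDM probability-flow ODE $\mathrm dx_t=-t\,\nabla\log p_t(x_t)\,\mathrm dt$ started from $y\in\mathbb R^d$ at time $T$ is a curve $(x_t)_{0\le t\le T}$ such that $t\mapsto t\,\nabla\log p_t(x_t)$ is integrable on $[0,T]$ and $$x_t=y-\int_T^t\tau\,\nabla\log p_\tau(x_\tau)\,\mathrm d\tau\qquad(0\le t\le T).$$ The noise-to-data map is $\Phi_p(y)=x_0=y-\int_T^0 t\,\nabla\log p_t(x_t)\,\mathrm dt$ (set to $0$ if no trajectory from $y$ exists). With the image descriptor taken to be the identity, the probability flow distance is $$\mathtt{PFD}(p,q)=\Big(\mathbb E_{x_T\sim\mathcal N(0,T^2I)}\|\Phi_p(x_T)-\Phi_q(x_T)\|_2^2\Big)^{1/2}.$$ **Theorem.** For all Borel probability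 measures $p,q,p'$ on $\mathbb R^d$, the distance is well defined: for $\mathcal N(0,T^2I)$-almost every $y$ a trajectory started from $y$ exists, for every $y$ there is at most one on $[0,T]$, and $\|\Phi_p-\Phi_q\|_2^2$ is integrable with respect to $\mathcal N(0,T^2I)$. Moreover, $\mathtt{PFD}$ is a metric: 1. (Positivity) $\mathtt{PFD}(p,q)>0$ whenever $p\neq q$. 2. (Identity of indiscernibles) $\mathtt{PFD}(p,q)=0$ if and only if $p=q$. 3. (Symmetry) $\mathtt{PFD}(p,q)=\mathtt{PFD}(q,p)$. 4. (Triangle inequality) $\mathtt{PFD}(p,q)\le\mathtt{PFD}(p,p')+\mathtt{PFD}(p',q)$. -/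

import Mathlib

open MeasureTheory ProbabilityTheory Set

noncomputable section

namespace PFD

/-- The data space `ℝᵈ` with its Euclidean norm. -/
abbrev E (d : ℕ) : Type := EuclideanSpace ℝ (Fin d)

/-- The Gaussian law `N(0, t² I)` on `ℝᵈ`. -/
def noise (d : ℕ) (t : ℝ) : Measure (E d) :=
  (stdGaussian (E d)).map (fun z => t • z)

/-- The Lebesgue density of `N(0, t² I)` on `ℝᵈ`, for `t > 0`. -/
def noiseDensity (d : ℕ) (t : ℝ) (z : E d) : ℝ :=
  ((2 * Real.pi * t ^ 2) ^ ((d : ℝ) / 2))⁻¹ * Real.exp (-(‖z‖ ^ 2 / (2 * t ^ 2)))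

/-- The law `p_t` of the forward process `x_t = x_0 + ∫₀ᵗ √(2τ) dw_τ` with `x_0 ∼ p`. The Wiener
integral is independent of `x_0`, centred Gaussian, with covariance `(∫₀ᵗ 2τ dτ) I = t² I`. -/
def forwardLaw {d : ℕ} (p : Measure (E d)) (t : ℝ) : Measure (E d) :=
  p ∗ noise d t

/-- The (smooth, positive) Lebesgue density of `p_t`, for `t > 0`;
see `forwardLaw_eq_withDensity`. -/
def forwardDensity {d : ℕ} (p : Measure (E d)) (t : ℝ) (x : E d) : ℝ :=
  ∫ y, noiseDensity d t (x - y) ∂p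

theorem noiseDensity_nonneg (d : ℕ) (t : ℝ) (z : E d) : 0 ≤ noiseDensity d t z := by
  unfold noiseDensity; positivity

theorem continuous_noiseDensity (d : ℕ) (t : ℝ) : Continuous (noiseDensity d t) := by
  unfold noiseDensity; fun_prop

theorem integrable_noiseDensity (d : ℕ) {t : ℝ} (ht : 0 < t) :
    Integrable (noiseDensity d t) volume := by
  unfold noiseDensity
  apply Integrable.const_mul
  have hb : 0 < ((1 / (2 * t ^ 2) : ℝ) : ℂ).re := by rw [Complex.ofReal_re]; positivity
  have h := (GaussianFourier.integrable_cexp_neg_mul_sq_norm_add (V := E d) hb 0 0).norm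
  refine h.congr (Filter.Eventually.of_forall fun v => ?_)
  have : (-((1 / (2 * t ^ 2) : ℝ) : ℂ) * (‖v‖ : ℂ) ^ 2 + 0 * ((inner ℝ (0 : E d) v : ℝ) : ℂ))
      = ((-(‖v‖ ^ 2 / (2 * t ^ 2)) : ℝ) : ℂ) := by
    push_cast; ring
  simp only [this, Complex.norm_exp, Complex.ofReal_re]

theorem noise_eq_withDensity (d : ℕ) {t : ℝ} (ht : 0 < t) :
    noise d t = volume.withDensity (fun z => ENNReal.ofReal (noiseDensity d t z)) := by
  have hint := integrable_noiseDensity d ht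
  have : IsFiniteMeasure
      (volume.withDensity (fun z => ENNReal.ofReal (noiseDensity d t z))) :=
    isFiniteMeasure_withDensity_ofReal hint.2
  have : IsProbabilityMeasure (noise d t) :=
    Measure.isProbabilityMeasure_map (by fun_prop)
  apply Measure.ext_of_charFun
  ext w
  rw [noise, charFun_map_smul, charFun_stdGaussian, charFun_apply,
    integral_withDensity_eq_integral_toReal_smul
      (continuous_noiseDensity d t).measurable.ennreal_ofReal (by simp)]
  have hb : 0 < ((1 / (2 * t ^ 2) : ℝ) : ℂ).re := by rw [Complex.ofReal_re]; positivity
  have h := GaussianFourier.integral_cexp_neg_mul_sq_norm_add (V := E d) hb Complex.I w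
  have hpos : (0 : ℝ) < (2 * Real.pi * t ^ 2) ^ ((d : ℝ) / 2) := by positivity
  have hpi : ((Real.pi : ℂ) / ((1 / (2 * t ^ 2) : ℝ) : ℂ)) ^ (Module.finrank ℝ (E d) / 2 : ℂ)
      = (((2 * Real.pi * t ^ 2) ^ ((d : ℝ) / 2) : ℝ) : ℂ) := by
    rw [Complex.ofReal_cpow (by positivity)]
    congr 1
    · push_cast; field_simp
    · simp
  have hfun : ∀ v : E d, (ENNReal.ofReal (noiseDensity d t v)).toReal •
      Complex.exp ((inner ℝ v w : ℝ) * Complex.I) =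
      (((2 * Real.pi * t ^ 2) ^ ((d : ℝ) / 2) : ℝ) : ℂ)⁻¹ *
        Complex.exp (-((1 / (2 * t ^ 2) : ℝ) : ℂ) * (‖v‖ : ℂ) ^ 2
          + Complex.I * ((inner ℝ w v : ℝ) : ℂ)) := by
    intro v
    rw [ENNReal.toReal_ofReal (noiseDensity_nonneg d t v), noiseDensity, Complex.real_smul,
      Complex.exp_add, real_inner_comm, Complex.ofReal_mul, Complex.ofReal_exp,
      Complex.ofReal_inv, mul_assoc, mul_comm Complex.I]
    congr 3
    push_cast; ring_nf
  simp_rw [hfun]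
  rw [integral_const_mul, h, hpi, ← mul_assoc,
    inv_mul_cancel₀ (by exact_mod_cast hpos.ne'), one_mul, norm_smul]
  congr 1
  have : (t : ℂ) ≠ 0 := by exact_mod_cast ht.ne'
  simp only [Real.norm_eq_abs, Complex.ofReal_mul, mul_pow, Complex.I_sq]
  rw [← Complex.ofReal_pow |t|, sq_abs]
  push_cast
  field_simp
  ring

/-- `forwardDensity p t` is the density of `p_t`. -/
theorem forwardLaw_eq_withDensity {d : ℕ} (p : Measure (E d)) [IsProbabilityMeasure p]
    {t : ℝ} (ht : 0 < t) :
    forwardLaw p t = volume.withDensity (fun x => ENNReal.ofReal (forwardDensity p t x)) := by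
  have hm : Measurable (fun z : E d => ENNReal.ofReal (noiseDensity d t z)) :=
    (continuous_noiseDensity d t).measurable.ennreal_ofReal
  have hd : ∀ x : E d, ENNReal.ofReal (forwardDensity p t x) =
      ∫⁻ y, ENNReal.ofReal (noiseDensity d t (x - y)) ∂p := by
    intro x
    rw [forwardDensity, ofReal_integral_eq_lintegral_ofReal _
      (Filter.Eventually.of_forall fun y => noiseDensity_nonneg d t _)]
    refine Integrable.of_bound (C := ((2 * Real.pi * t ^ 2) ^ ((d : ℝ) / 2))⁻¹)
      ((continuous_noiseDensity d t).comp (by fun_prop)).aestronglyMeasurable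
      (Filter.Eventually.of_forall fun y => ?_)
    rw [Real.norm_of_nonneg (noiseDensity_nonneg d t _), noiseDensity]
    refine mul_le_of_le_one_right (by positivity) (Real.exp_le_one_iff.2 ?_)
    exact neg_nonpos.2 (by positivity)
  ext A hA
  have hi : Measurable (A.indicator (fun _ => (1 : ENNReal))) := measurable_const.indicator hA
  have h1 : forwardLaw p t A = ∫⁻ z, A.indicator (fun _ => (1 : ENNReal)) z ∂(forwardLaw p t) := by
    simp [lintegral_indicator hA]
  rw [h1, forwardLaw, noise_eq_withDensity d ht, Measure.lintegral_conv hi,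
    withDensity_apply _ hA, ← lintegral_indicator hA]
  have h2 : ∀ y : E d, ∫⁻ z, A.indicator (fun _ => (1 : ENNReal)) (y + z)
      ∂(volume.withDensity (fun z => ENNReal.ofReal (noiseDensity d t z))) =
      ∫⁻ x, ENNReal.ofReal (noiseDensity d t (x - y)) * A.indicator (fun _ => (1 : ENNReal)) x := by
    intro y
    rw [lintegral_withDensity_eq_lintegral_mul _ hm (by fun_prop),
      ← lintegral_add_left_eq_self
        (fun x => ENNReal.ofReal (noiseDensity d t (x - y)) * A.indicator (fun _ => (1 : ENNReal)) x) y]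
    simp
  simp_rw [h2]
  rw [lintegral_lintegral_swap]
  · refine lintegral_congr fun x => ?_
    by_cases hx : x ∈ A <;> simp [hx, hd]
  · apply Measurable.aemeasurable
    exact (hm.comp (by fun_prop : Measurable fun a : E d × E d => a.2 - a.1)).mul
      (hi.comp measurable_snd)

/-- The score function `∇ log p_t`. -/
def score {d : ℕ} (p : Measure (E d)) (t : ℝ) (x : E d) : E d :=
  gradient (fun z => Real.log (forwardDensity p t z)) x

/-- `x` is a trajectory on `[0, T]` of the probability-flow ODE `dx_t = -t ∇ log p_t(x_t) dt`,
started from `y` at time `T`: the ODE is read in its integral form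
`x_t = y - ∫_T^t τ ∇ log p_τ(x_τ) dτ` for `0 ≤ t ≤ T`, with an integrable velocity
(the score may be singular at time `0`). -/
structure IsTrajectory {d : ℕ} (p : Measure (E d)) (T : ℝ) (y : E d) (x : ℝ → E d) : Prop where
  integrable : IntervalIntegrable (fun τ => τ • score p τ (x τ)) volume T 0
  eq : ∀ t ∈ Icc (0 : ℝ) T, x t = y - ∫ τ in T..t, τ • score p τ (x τ)

open Classical in
/-- The noise-to-data map `Φ_p(y) = y - ∫_T^0 t ∇ log p_t(x_t) dt`, where `x` is the trajectory
started from `y` at time `T` (value `0` where there is no trajectory). -/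
def noiseToData {d : ℕ} (p : Measure (E d)) (T : ℝ) (y : E d) : E d :=
  if h : ∃ x : ℝ → E d, IsTrajectory p T y x then
    y - ∫ t in T..0, t • score p t (h.choose t)
  else 0

/-- The probability flow distance with terminal time `T` and image descriptor `Ψ`. -/
def pfd {d : ℕ} {F : Type*} [NormedAddCommGroup F] (Ψ : E d → F) (T : ℝ)
    (p q : Measure (E d)) : ℝ :=
  Real.sqrt (∫ y, ‖Ψ (noiseToData p T y) - Ψ (noiseToData q T y)‖ ^ 2 ∂(noise d T))

end PFD

end

namespace PFD

open Filter Metric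
open scoped Topology NNReal ENNReal

/-! ### Flows of locally Lipschitz fields of linear growth on positive times. -/

section ODE

variable {F : Type*} [NormedAddCommGroup F] [NormedSpace ℝ F]

/-! By Tweedie's formula the velocity `v_t = -t ∇ log p_t` is the posterior mean of `z` given `x_t`,
in the coupling `x_t = x_0 + t z` with `z` standard Gaussian (`smul_score`,
`integral_noise_sub_drift_eq_zero`). Away from time `0` it is locally Lipschitz of linear growth
(`isTameField_drift`), so it has a flow `φ` on positive times. The flow carries `p_s` to `p_t`
(`map_flow_forwardLaw`): with `u = w ∘ φ s t`, the `s`-derivative of `E w(φ s t x_s)` is `E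
Du(x_s)(z - v_s(x_s))`, which vanishes because `v_s(x_s)` is the conditional mean of `z`.

Jensen bounds `E ‖v_t(x_t)‖⁴` by `E ‖z‖⁴`, uniformly in `t`. Hence for `p_T`-almost every start the
speed is integrable down to time `0`, the map `Φ_p` pushes `p_T` to `p`
(`map_noiseToData_forwardLaw`), and the displacement `Φ_p(y) - y` is in `L⁴(p_T)`. The density of
the noise with respect to `p_T` is in `L²(p_T)`, so the displacement is in `L²` of the noise
(`memLp_noiseToData_sub`). The distance is then an `L²` norm of `Φ_p - Φ_q`, which gives symmetry
and the triangle inequality.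

If the distance vanishes, `Φ_p` and `Φ_q` agree Lebesgue-almost everywhere with one map `Φ`, and `p`
and `q` are both invariant under the Markov chain `x ↦ Φ(x + T z)`. As the noise has a positive
density, such a chain has at most one invariant probability measure (`eq_of_map_conv_noise_eq`). -/

theorem hasDerivWithinAt_reverse {a b : ℝ} {x x' : ℝ → F}
    (hx : ∀ t ∈ Icc a b, HasDerivWithinAt x (x' t) (Icc a b) t) :
    ∀ t ∈ Icc a b, HasDerivWithinAt (fun t => x (a + b - t)) (-x' (a + b - t)) (Icc a b) t := by
  intro t ht
  have hmaps : MapsTo (fun t : ℝ => a + b - t) (Icc a b) (Icc a b) := fun s hs =>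
    ⟨by linarith [hs.2], by linarith [hs.1]⟩
  have h := HasDerivWithinAt.scomp (h := fun t : ℝ => a + b - t) (h' := -1) t
    (hx _ (hmaps ht)) (((hasDerivAt_id t).const_sub (a + b)).hasDerivWithinAt) hmaps
  simpa [Function.comp_def] using h

/-- Grönwall's inequality from the left end point. -/
theorem norm_le_gronwallBound_of_left {a b K ε : ℝ} {x x' : ℝ → F}
    (hx : ∀ t ∈ Icc a b, HasDerivWithinAt x (x' t) (Icc a b) t)
    (hK : ∀ t ∈ Icc a b, ‖x' t‖ ≤ K * ‖x t‖ + ε) {t : ℝ} (ht : t ∈ Icc a b) :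
    ‖x t‖ ≤ gronwallBound ‖x a‖ K ε (t - a) :=
  norm_le_gronwallBound_of_norm_deriv_right_le (fun s hs => (hx s hs).continuousWithinAt)
    (fun s hs => (hx s (Ico_subset_Icc_self hs)).mono_of_mem_nhdsWithin
      (Icc_mem_nhdsGE_of_mem hs)) le_rfl (fun s hs => hK s (Ico_subset_Icc_self hs)) t ht

/-- Grönwall's inequality in both time directions. -/
theorem norm_le_gronwallBound_abs {a b K ε : ℝ} {x x' : ℝ → F}
    (hx : ∀ t ∈ Icc a b, HasDerivWithinAt x (x' t) (Icc a b) t)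
    (hK : ∀ t ∈ Icc a b, ‖x' t‖ ≤ K * ‖x t‖ + ε) {s t : ℝ}
    (hs : s ∈ Icc a b) (ht : t ∈ Icc a b) :
    ‖x t‖ ≤ gronwallBound ‖x s‖ K ε |t - s| := by
  rcases le_total s t with hst | hst
  · have hsub : Icc s t ⊆ Icc a b := Icc_subset_Icc hs.1 ht.2
    rw [abs_of_nonneg (by linarith)]
    exact norm_le_gronwallBound_of_left (fun r hr => (hx r (hsub hr)).mono hsub)
      (fun r hr => hK r (hsub hr)) ⟨hst, le_rfl⟩
  · have hsub : Icc t s ⊆ Icc a b := Icc_subset_Icc ht.1 hs.2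
    have h := norm_le_gronwallBound_of_left (K := K) (ε := ε)
      (hasDerivWithinAt_reverse (fun r hr => (hx r (hsub hr)).mono hsub))
      (fun r hr => by
        rw [norm_neg]
        exact hK _ (hsub ⟨by linarith [hr.2], by linarith [hr.1]⟩)) (right_mem_Icc.2 hst)
    rw [abs_sub_comm, abs_of_nonneg (by linarith)]
    simpa using h

/-- With both Grönwall constants equal to `C`, the quantity `1 + ‖x‖` grows at most exponentially;
using `b - a` for the elapsed time gives one bound for all pairs of times. -/
theorem one_add_norm_le_exp {a b C : ℝ} (hC : 0 < C) {x x' : ℝ → F}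
    (hx : ∀ t ∈ Icc a b, HasDerivWithinAt x (x' t) (Icc a b) t)
    (hK : ∀ t ∈ Icc a b, ‖x' t‖ ≤ C * (1 + ‖x t‖)) {s t : ℝ}
    (hs : s ∈ Icc a b) (ht : t ∈ Icc a b) :
    1 + ‖x t‖ ≤ (1 + ‖x s‖) * Real.exp (C * (b - a)) := by
  have h := norm_le_gronwallBound_abs (K := C) (ε := C) hx
    (fun r hr => (hK r hr).trans_eq (by ring)) hs ht
  rw [gronwallBound_of_K_ne_0 hC.ne', div_self hC.ne'] at h
  have h2 : Real.exp (C * |t - s|) ≤ Real.exp (C * (b - a)) := by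
    gcongr
    exact abs_le.2 ⟨by linarith [hs.2, ht.1], by linarith [ht.2, hs.1]⟩
  nlinarith [norm_nonneg (x s)]

theorem norm_sub_le_of_growth {a b C : ℝ} (hC : 0 < C) {x x' : ℝ → F}
    (hx : ∀ t ∈ Icc a b, HasDerivWithinAt x (x' t) (Icc a b) t)
    (hK : ∀ t ∈ Icc a b, ‖x' t‖ ≤ C * (1 + ‖x t‖)) {s t : ℝ}
    (hs : s ∈ Icc a b) (ht : t ∈ Icc a b) :
    ‖x t - x s‖ ≤ C * Real.exp (C * (b - a)) * |t - s| * (1 + ‖x s‖) := by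
  have h := (convex_Icc a b).norm_image_sub_le_of_norm_hasDerivWithin_le hx
    (C := C * ((1 + ‖x s‖) * Real.exp (C * (b - a))))
    (fun r hr => (hK r hr).trans
      (mul_le_mul_of_nonneg_left (one_add_norm_le_exp hC hx hK hs hr) hC.le)) hs ht
  rw [Real.norm_eq_abs] at h
  exact h.trans_eq (by ring)

theorem norm_sub_le_of_lipschitzOn {a b R : ℝ} {K : ℝ≥0} {v : ℝ → F → F}
    (hv : ∀ t ∈ Icc a b, LipschitzOnWith K (v t) (closedBall 0 R)) {x y : ℝ → F}
    (hx : ∀ t ∈ Icc a b, HasDerivWithinAt x (v t (x t)) (Icc a b) t)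
    (hy : ∀ t ∈ Icc a b, HasDerivWithinAt y (v t (y t)) (Icc a b) t)
    (hxR : ∀ t ∈ Icc a b, ‖x t‖ ≤ R) (hyR : ∀ t ∈ Icc a b, ‖y t‖ ≤ R) {s t : ℝ}
    (hs : s ∈ Icc a b) (ht : t ∈ Icc a b) :
    ‖x t - y t‖ ≤ Real.exp (K * (b - a)) * ‖x s - y s‖ := by
  have h := norm_le_gronwallBound_abs (x := fun t => x t - y t) (K := K) (ε := 0)
    (fun r hr => (hx r hr).sub (hy r hr)) (fun r hr => by
      have := (hv r hr).norm_sub_le (mem_closedBall_zero_iff.2 (hxR r hr))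
        (mem_closedBall_zero_iff.2 (hyR r hr))
      simpa using this) hs ht
  rw [gronwallBound_ε0] at h
  refine h.trans ?_
  rw [mul_comm]
  gcongr
  exact abs_le.2 ⟨by linarith [hs.2, ht.1], by linarith [ht.2, hs.1]⟩

/-- A time-dependent vector field on `(0, ∞)`, locally Lipschitz and of linear growth,
locally uniformly in time. -/
structure IsTameField (v : ℝ → F → F) : Prop where
  continuousOn : ContinuousOn (fun z : ℝ × F => v z.1 z.2) (Ioi 0 ×ˢ univ)
  lipschitzOn : ∀ a b R : ℝ, 0 < a →
    ∃ K : ℝ≥0, ∀ t ∈ Icc a b, LipschitzOnWith K (v t) (closedBall 0 R)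
  growth : ∀ a : ℝ, 0 < a → ∃ C : ℝ, 0 < C ∧ ∀ t, a ≤ t → ∀ x, ‖v t x‖ ≤ C * (1 + ‖x‖)

section

variable {F : Type*} [NormedAddCommGroup F]

/-- A Lipschitz cutoff, `1` on the ball of radius `R` and `0` off the ball of radius `R + 1`. -/
noncomputable def cutoff (R : ℝ) (x : F) : ℝ := max 0 (min 1 (R + 1 - ‖x‖))

theorem cutoff_nonneg (R : ℝ) (x : F) : 0 ≤ cutoff R x := le_max_left _ _

theorem cutoff_le_one (R : ℝ) (x : F) : cutoff R x ≤ 1 := max_le zero_le_one (min_le_left _ _)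

theorem cutoff_eq_one {R : ℝ} {x : F} (hx : ‖x‖ ≤ R) : cutoff R x = 1 := by
  rw [cutoff, min_eq_left (by linarith), max_eq_right zero_le_one]

theorem cutoff_eq_zero {R : ℝ} {x : F} (hx : R + 1 < ‖x‖) : cutoff R x = 0 := by
  rw [cutoff, max_eq_left ((min_le_right _ _).trans (by linarith))]

theorem abs_cutoff_sub_le (R : ℝ) (x y : F) : |cutoff R x - cutoff R y| ≤ ‖x - y‖ := by
  unfold cutoff
  calc |max 0 (min 1 (R + 1 - ‖x‖)) - max 0 (min 1 (R + 1 - ‖y‖))|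
      ≤ |min 1 (R + 1 - ‖x‖) - min 1 (R + 1 - ‖y‖)| := by
        simpa using abs_max_sub_max_le_max 0 (min 1 (R + 1 - ‖x‖)) 0 (min 1 (R + 1 - ‖y‖))
    _ ≤ |(R + 1 - ‖x‖) - (R + 1 - ‖y‖)| := by
        simpa using abs_min_sub_min_le_max 1 (R + 1 - ‖x‖) 1 (R + 1 - ‖y‖)
    _ = |‖y‖ - ‖x‖| := by ring_nf
    _ ≤ ‖x - y‖ := by rw [norm_sub_rev]; exact abs_norm_sub_norm_le y x

end

/-- The cutoff turns bounds on a ball into global ones, so that Picard–Lindelöf applies on a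
prescribed time interval. -/
theorem norm_cutoff_smul_sub_le {R : ℝ} {K M : ℝ≥0} {f : F → F}
    (hf : LipschitzOnWith K f (closedBall 0 (R + 1))) (hM : ∀ x, ‖x‖ ≤ R + 1 → ‖f x‖ ≤ M)
    (x y : F) : ‖cutoff R x • f x - cutoff R y • f y‖ ≤ (K + M : ℝ≥0) * ‖x - y‖ := by
  have hcut := abs_cutoff_sub_le R x y
  push_cast
  by_cases hx : ‖x‖ ≤ R + 1
  · by_cases hy : ‖y‖ ≤ R + 1
    · have h : cutoff R x • f x - cutoff R y • f y =
          cutoff R x • (f x - f y) + (cutoff R x - cutoff R y) • f y := by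
        rw [smul_sub, sub_smul]; abel
      rw [h]
      refine (norm_add_le _ _).trans ?_
      rw [norm_smul, norm_smul, Real.norm_of_nonneg (cutoff_nonneg R x), Real.norm_eq_abs]
      have h1 := hf.norm_sub_le (mem_closedBall_zero_iff.2 hx) (mem_closedBall_zero_iff.2 hy)
      have h2 : cutoff R x * ‖f x - f y‖ ≤ 1 * (K * ‖x - y‖) :=
        mul_le_mul (cutoff_le_one R x) h1 (norm_nonneg _) zero_le_one
      have h3 : |cutoff R x - cutoff R y| * ‖f y‖ ≤ ‖x - y‖ * M :=
        mul_le_mul hcut (hM y hy) (norm_nonneg _) (norm_nonneg _)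
      linarith
    · rw [cutoff_eq_zero (not_le.1 hy), zero_smul, sub_zero, norm_smul, Real.norm_eq_abs]
      rw [cutoff_eq_zero (not_le.1 hy), sub_zero] at hcut
      have h3 : |cutoff R x| * ‖f x‖ ≤ ‖x - y‖ * M :=
        mul_le_mul hcut (hM x hx) (norm_nonneg _) (norm_nonneg _)
      nlinarith [mul_nonneg K.coe_nonneg (norm_nonneg (x - y))]
  · rw [cutoff_eq_zero (not_le.1 hx), zero_smul, zero_sub, norm_neg]
    by_cases hy : ‖y‖ ≤ R + 1
    · rw [norm_smul, Real.norm_eq_abs]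
      rw [cutoff_eq_zero (not_le.1 hx), zero_sub, abs_neg] at hcut
      have h3 : |cutoff R y| * ‖f y‖ ≤ ‖x - y‖ * M :=
        mul_le_mul hcut (hM y hy) (norm_nonneg _) (norm_nonneg _)
      nlinarith [mul_nonneg K.coe_nonneg (norm_nonneg (x - y))]
    · rw [cutoff_eq_zero (not_le.1 hy), zero_smul, norm_zero]
      positivity

namespace IsTameField

variable {v : ℝ → F → F}

/-- The truncated field is bounded, so Picard–Lindelöf solves it on all of `[a, b]`. Truncation only
lowers the speed, so the growth bound persists, and the resulting a priori bound `R` keeps the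
solution where the cutoff equals one. -/
theorem exists_solution_Icc [CompleteSpace F] (hv : IsTameField v) {a b t₀ : ℝ} (ha : 0 < a)
    (ht₀ : t₀ ∈ Icc a b) (x₀ : F) :
    ∃ x : ℝ → F, x t₀ = x₀ ∧ ∀ t ∈ Icc a b, HasDerivWithinAt x (v t (x t)) (Icc a b) t := by
  obtain ⟨C, hC, hgrow⟩ := hv.growth a ha
  set R : ℝ := (1 + ‖x₀‖) * Real.exp (C * (b - a)) with hR
  have hR0 : 0 ≤ R := by positivity
  obtain ⟨K, hK⟩ := hv.lipschitzOn a b (R + 1) ha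
  set M : ℝ≥0 := ⟨C * (2 + R), by positivity⟩
  have hM : ∀ t ∈ Icc a b, ∀ x, ‖x‖ ≤ R + 1 → ‖v t x‖ ≤ M := fun t ht x hx =>
    (hgrow t ht.1 x).trans (mul_le_mul_of_nonneg_left (by linarith) hC.le)
  have hab : 0 ≤ b - a := by linarith [ht₀.1, ht₀.2]
  have hPL : IsPicardLindelof (fun t x => cutoff R x • v t x) (⟨t₀, ht₀⟩ : Icc a b) x₀
      (M * ⟨b - a, hab⟩) 0 M (K + M) := by
    refine ⟨fun t ht => ?_, fun x _ => ?_, fun t ht x _ => ?_, ?_⟩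
    · refine LipschitzOnWith.of_dist_le_mul fun x _ y _ => ?_
      rw [dist_eq_norm, dist_eq_norm]
      exact norm_cutoff_smul_sub_le (hK t ht) (hM t ht) x y
    · refine continuousOn_const.smul (hv.continuousOn.comp
        (f := fun t : ℝ => (t, x)) (by fun_prop) fun t ht => ?_)
      exact ⟨ha.trans_le ht.1, mem_univ _⟩
    · rw [norm_smul, Real.norm_of_nonneg (cutoff_nonneg R x)]
      by_cases hx : ‖x‖ ≤ R + 1
      · calc cutoff R x * ‖v t x‖ ≤ 1 * M :=
            mul_le_mul (cutoff_le_one R x) (hM t ht x hx) (norm_nonneg _) zero_le_one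
          _ = M := one_mul _
      · rw [cutoff_eq_zero (not_le.1 hx), zero_mul]; exact M.2
    · rw [NNReal.coe_zero, sub_zero]
      exact mul_le_mul_of_nonneg_left
        (max_le (by linarith [ht₀.1]) (by linarith [ht₀.2])) M.2
  obtain ⟨x, hx0, hx⟩ := hPL.exists_eq_forall_mem_Icc_hasDerivWithinAt₀
  refine ⟨x, hx0, fun t ht => ?_⟩
  have hle : ∀ t ∈ Icc a b, ‖cutoff R (x t) • v t (x t)‖ ≤ C * (1 + ‖x t‖) := fun t ht => by
    rw [norm_smul, Real.norm_of_nonneg (cutoff_nonneg R _)]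
    exact (mul_le_of_le_one_left (norm_nonneg _) (cutoff_le_one R _)).trans (hgrow t ht.1 _)
  have hb := one_add_norm_le_exp hC hx hle ht₀ ht
  simp only [hx0, ← hR] at hb
  have h := hx t ht
  rwa [cutoff_eq_one (by linarith), one_smul] at h

theorem eqOn_Icc (hv : IsTameField v) {a b s : ℝ} (ha : 0 < a) (hs : s ∈ Icc a b) {x y : ℝ → F}
    (hx : ∀ t ∈ Icc a b, HasDerivWithinAt x (v t (x t)) (Icc a b) t)
    (hy : ∀ t ∈ Icc a b, HasDerivWithinAt y (v t (y t)) (Icc a b) t)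
    (hxy : x s = y s) : EqOn x y (Icc a b) := by
  obtain ⟨C, hC, hgrow⟩ := hv.growth a ha
  set R : ℝ := (1 + ‖x s‖) * Real.exp (C * (b - a))
  obtain ⟨K, hK⟩ := hv.lipschitzOn a b R ha
  intro t ht
  have h := norm_sub_le_of_lipschitzOn hK hx hy
    (fun r hr => by
      linarith [one_add_norm_le_exp hC hx (fun t ht => hgrow t ht.1 _) hs hr])
    (fun r hr => by
      have := one_add_norm_le_exp hC hy (fun t ht => hgrow t ht.1 _) hs hr
      rw [← hxy] at this
      linarith) hs ht
  rw [hxy, sub_self, norm_zero, mul_zero] at h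
  exact sub_eq_zero.1 (norm_le_zero_iff.1 h)

end IsTameField

/-- `φ s t x` is the position at time `t` of the solution of `x' = v(t, x)` that sits at `x` at
time `s`, for positive times. -/
structure IsFlow (v : ℝ → F → F) (φ : ℝ → ℝ → F → F) : Prop where
  self : ∀ s x, 0 < s → φ s s x = x
  hasDerivAt : ∀ s x, 0 < s → ∀ t, 0 < t → HasDerivAt (fun r => φ s r x) (v t (φ s t x)) t

namespace IsTameField

variable {v : ℝ → F → F} {φ : ℝ → ℝ → F → F}

/-- Solutions on compact intervals agree on overlaps, so the value at `t` can be read off the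
solution attached to `t`. The enlarged interval has `t` in its interior, which yields a two-sided
derivative. -/
theorem exists_solution [CompleteSpace F] (hv : IsTameField v) {s : ℝ} (hs : 0 < s) (x₀ : F) :
    ∃ x : ℝ → F, x s = x₀ ∧ ∀ t, 0 < t → HasDerivAt x (v t (x t)) t := by
  have hex : ∀ t : ℝ, ∃ x : ℝ → F, 0 < t → (x s = x₀ ∧ ∀ r ∈ Icc (min s t / 2) (max s t + 1),
      HasDerivWithinAt x (v r (x r)) (Icc (min s t / 2) (max s t + 1)) r) := by
    intro t
    by_cases ht : 0 < t
    · have hm : 0 < min s t := lt_min hs ht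
      obtain ⟨x, hx⟩ := hv.exists_solution_Icc (a := min s t / 2) (b := max s t + 1) (t₀ := s)
        (by positivity)
        ⟨by linarith [min_le_left s t], by linarith [le_max_left s t]⟩ x₀
      exact ⟨x, fun _ => hx⟩
    · exact ⟨fun _ => 0, fun h => absurd h ht⟩
  choose y hy using hex
  have hsub : ∀ r t : ℝ, 0 < t → r ∈ Ioo (min s t / 2) (max s t + 1) → y r r = y t r := by
    intro r t ht hr
    have hm : 0 < min s t := lt_min hs ht
    have hr0 : 0 < r := by linarith [hr.1]
    have hm' : 0 < min s r := lt_min hs hr0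
    have h1 : Icc (min s r) (max s r) ⊆ Icc (min s r / 2) (max s r + 1) :=
      Icc_subset_Icc (by linarith) (by linarith)
    have h2 : Icc (min s r) (max s r) ⊆ Icc (min s t / 2) (max s t + 1) :=
      Icc_subset_Icc (le_min (by linarith [min_le_left s t]) hr.1.le)
        (max_le (by linarith [le_max_left s t]) hr.2.le)
    refine hv.eqOn_Icc hm' ⟨min_le_left _ _, le_max_left _ _⟩
      (fun q hq => ((hy r hr0).2 q (h1 hq)).mono h1)
      (fun q hq => ((hy t ht).2 q (h2 hq)).mono h2) ?_ ⟨min_le_right _ _, le_max_right _ _⟩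
    rw [(hy r hr0).1, (hy t ht).1]
  refine ⟨fun t => y t t, (hy s hs).1, fun t ht => ?_⟩
  have hm : 0 < min s t := lt_min hs ht
  have hmem : t ∈ Ioo (min s t / 2) (max s t + 1) :=
    ⟨by linarith [min_le_right s t], by linarith [le_max_right s t]⟩
  have h := ((hy t ht).2 t (Ioo_subset_Icc_self hmem)).hasDerivAt
    (Icc_mem_nhds hmem.1 hmem.2)
  refine h.congr_of_eventuallyEq ?_
  filter_upwards [Ioo_mem_nhds hmem.1 hmem.2] with r hr using hsub r t ht hr

theorem exists_isFlow [CompleteSpace F] (hv : IsTameField v) : ∃ φ, IsFlow v φ := by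
  have hex : ∀ (s : ℝ) (x₀ : F), ∃ x : ℝ → F, 0 < s →
      (x s = x₀ ∧ ∀ t, 0 < t → HasDerivAt x (v t (x t)) t) := by
    intro s x₀
    by_cases hs : 0 < s
    · obtain ⟨x, hx⟩ := hv.exists_solution hs x₀
      exact ⟨x, fun _ => hx⟩
    · exact ⟨fun _ => 0, fun h => absurd h hs⟩
  choose y hy using hex
  exact ⟨fun s t x => y s x t, fun s x hs => (hy s x hs).1, fun s x hs => (hy s x hs).2⟩

theorem eq_of_hasDerivAt (hv : IsTameField v) {x y : ℝ → F}
    (hx : ∀ t, 0 < t → HasDerivAt x (v t (x t)) t)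
    (hy : ∀ t, 0 < t → HasDerivAt y (v t (y t)) t) {s t : ℝ} (hs : 0 < s) (ht : 0 < t)
    (hxy : x s = y s) : x t = y t := by
  have hm : 0 < min s t := lt_min hs ht
  exact hv.eqOn_Icc hm (b := max s t) ⟨min_le_left _ _, le_max_left _ _⟩
    (fun r hr => (hx r (hm.trans_le hr.1)).hasDerivWithinAt)
    (fun r hr => (hy r (hm.trans_le hr.1)).hasDerivWithinAt) hxy
    ⟨min_le_right _ _, le_max_right _ _⟩

end IsTameField

namespace IsFlow

variable {v : ℝ → F → F} {φ : ℝ → ℝ → F → F}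

theorem comp (hφ : IsFlow v φ) (hv : IsTameField v) {r s t : ℝ} (hr : 0 < r) (hs : 0 < s)
    (ht : 0 < t) (x : F) : φ s t (φ r s x) = φ r t x :=
  hv.eq_of_hasDerivAt (hφ.hasDerivAt s _ hs) (hφ.hasDerivAt r x hr) hs ht (hφ.self s _ hs)

theorem hasDerivWithinAt (hφ : IsFlow v φ) {a b s : ℝ} (ha : 0 < a) (hs : 0 < s) (x : F) :
    ∀ t ∈ Icc a b, HasDerivWithinAt (fun r => φ s r x) (v t (φ s t x)) (Icc a b) t :=
  fun t ht => (hφ.hasDerivAt s x hs t (ha.trans_le ht.1)).hasDerivWithinAt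

/-- Linear growth gives a constant valid for all starting points, not only those in a ball; the
dominating functions used later come from here. -/
theorem exists_norm_sub_le (hφ : IsFlow v φ) (hv : IsTameField v) {a b : ℝ} (ha : 0 < a) :
    ∃ C, 0 < C ∧ ∀ s ∈ Icc a b, ∀ t ∈ Icc a b, ∀ x,
      ‖φ s t x - x‖ ≤ C * |t - s| * (1 + ‖x‖) := by
  obtain ⟨C, hC, hgrow⟩ := hv.growth a ha
  refine ⟨C * Real.exp (C * (b - a)), by positivity, fun s hs t ht x => ?_⟩
  have hs0 := ha.trans_le hs.1
  have h := norm_sub_le_of_growth hC (hφ.hasDerivWithinAt ha hs0 x)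
    (fun t ht => hgrow t ht.1 _) hs ht
  rwa [hφ.self s x hs0] at h

theorem exists_lipschitzOnWith (hφ : IsFlow v φ) (hv : IsTameField v) {s t : ℝ} (hs : 0 < s)
    (ht : 0 < t) (R : ℝ) : ∃ K : ℝ≥0, LipschitzOnWith K (φ s t) (closedBall 0 R) := by
  have hm : 0 < min s t := lt_min hs ht
  obtain ⟨C, hC, hgrow⟩ := hv.growth _ hm
  obtain ⟨K, hK⟩ := hv.lipschitzOn _ (max s t)
    ((1 + R) * Real.exp (C * (max s t - min s t))) hm
  have hsI : s ∈ Icc (min s t) (max s t) := ⟨min_le_left _ _, le_max_left _ _⟩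
  have hball : ∀ x ∈ closedBall (0 : F) R, ∀ r ∈ Icc (min s t) (max s t),
      ‖φ s r x‖ ≤ (1 + R) * Real.exp (C * (max s t - min s t)) := by
    intro x hx r hr
    have h := one_add_norm_le_exp hC (hφ.hasDerivWithinAt hm hs x)
      (fun t ht => hgrow t ht.1 _) hsI hr
    rw [hφ.self s x hs] at h
    have h2 : (1 + ‖x‖) * Real.exp (C * (max s t - min s t)) ≤
      (1 + R) * Real.exp (C * (max s t - min s t)) := by
      gcongr; exact mem_closedBall_zero_iff.1 hx
    linarith
  refine ⟨⟨Real.exp (K * (max s t - min s t)), (Real.exp_pos _).le⟩,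
    LipschitzOnWith.of_dist_le_mul fun x hx y hy => ?_⟩
  have h := norm_sub_le_of_lipschitzOn hK (hφ.hasDerivWithinAt hm hs x)
    (hφ.hasDerivWithinAt hm hs y) (hball x hx) (hball y hy) hsI
    ⟨min_le_right _ _, le_max_right _ _⟩
  rwa [hφ.self s x hs, hφ.self s y hs, ← dist_eq_norm, ← dist_eq_norm] at h

theorem continuous (hφ : IsFlow v φ) (hv : IsTameField v) {s t : ℝ} (hs : 0 < s) (ht : 0 < t) :
    Continuous (φ s t) := by
  rw [continuous_iff_continuousAt]
  intro x
  obtain ⟨K, hK⟩ := hφ.exists_lipschitzOnWith hv hs ht (‖x‖ + 1)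
  refine hK.continuousOn.continuousAt (mem_of_superset (ball_mem_nhds x one_pos) ?_)
  intro y hy
  rw [mem_closedBall_zero_iff]
  have := norm_le_norm_add_norm_sub' y x
  rw [mem_ball, dist_eq_norm] at hy
  linarith

/-- The derivative at the diagonal of the flow in its initial time, along a line. -/
theorem hasDerivAt_diag (hφ : IsFlow v φ) (hv : IsTameField v) {s : ℝ} (hs : 0 < s) (x z : F) :
    HasDerivAt (fun r => φ r s (x + (r - s) • z)) (z - v s x) s := by
  obtain ⟨C, hC, hdisp⟩ := hφ.exists_norm_sub_le hv (a := s / 2) (b := 2 * s) (by positivity)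
  have hsI : s ∈ Icc (s / 2) (2 * s) := ⟨by linarith, by linarith⟩
  rw [hasDerivAt_iff_isLittleO, Asymptotics.isLittleO_iff]
  intro ε hε
  have hcont : ContinuousAt (fun z : ℝ × F => v z.1 z.2) (s, x) :=
    hv.continuousOn.continuousAt (prod_mem_nhds (Ioi_mem_nhds hs) univ_mem)
  obtain ⟨δ, hδ, hvδ⟩ := Metric.continuousAt_iff.1 hcont ε hε
  -- `B` collects the displacement along the flow, the shift by `(r - s) • z` and the time
  -- increment, so `|r - s| * B < δ` keeps the whole curve within `δ` of `(s, x)`.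
  set B : ℝ := C * (2 + ‖x‖ + s * ‖z‖) + ‖z‖ + 1 with hB
  have hBpos : 0 < B := by positivity
  have hev : ∀ᶠ r in 𝓝 s, |r - s| < min (s / 2) (δ / B) := by
    have : Tendsto (fun r => |r - s|) (𝓝 s) (𝓝 0) := by
      have h : Continuous fun r : ℝ => |r - s| := by fun_prop
      simpa using h.tendsto s
    exact this.eventually (gt_mem_nhds (by positivity))
  filter_upwards [hev] with r hr
  have hr1 : |r - s| < s / 2 := hr.trans_le (min_le_left _ _)
  have hr2 : |r - s| * B < δ := by
    have := hr.trans_le (min_le_right _ _)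
    rwa [lt_div_iff₀ hBpos] at this
  have hrI : r ∈ Icc (s / 2) (2 * s) := by
    constructor <;> linarith [(abs_lt.1 hr1).1, (abs_lt.1 hr1).2]
  have hr0 : 0 < r := by linarith [hrI.1]
  set x' : F := x + (r - s) • z with hx'
  have hxx' : ‖x' - x‖ = |r - s| * ‖z‖ := by
    rw [hx', add_sub_cancel_left, norm_smul, Real.norm_eq_abs]
  have hx'n : ‖x'‖ ≤ ‖x‖ + s * ‖z‖ := by
    have h1 := norm_le_norm_add_norm_sub' x' x
    rw [hxx'] at h1
    have : |r - s| * ‖z‖ ≤ s * ‖z‖ := by gcongr; linarith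
    linarith
  have hnear : ∀ q ∈ uIcc r s, ‖v q (φ r q x') - v s x‖ ≤ ε := by
    intro q hq
    have hqrs : |q - r| ≤ |r - s| := by
      rw [abs_sub_comm r s]; exact abs_sub_left_of_mem_uIcc hq
    have hqs : |q - s| ≤ |r - s| := by
      rw [abs_sub_comm q s]
      exact abs_sub_right_of_mem_uIcc hq |>.trans_eq (abs_sub_comm _ _)
    have hqI : q ∈ Icc (s / 2) (2 * s) := by
      have := abs_le.1 (hqs.trans hr1.le)
      constructor <;> linarith [this.1, this.2]
    have h1 := hdisp r hrI q hqI x'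
    have h2 : ‖φ r q x' - x‖ < δ := by
      have h3 : φ r q x' - x = (φ r q x' - x') + (x' - x) := by abel
      have h4 : C * |q - r| * (1 + ‖x'‖) ≤ C * |r - s| * (2 + ‖x‖ + s * ‖z‖) := by
        have h5 : 1 + ‖x'‖ ≤ 2 + ‖x‖ + s * ‖z‖ := by linarith
        gcongr
      rw [h3]
      refine (norm_add_le _ _).trans_lt ?_
      rw [hxx']
      nlinarith [abs_nonneg (r - s)]
    have h5 : dist ((q, φ r q x') : ℝ × F) (s, x) < δ := by
      rw [Prod.dist_eq, max_lt_iff]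
      refine ⟨?_, by rwa [dist_eq_norm]⟩
      rw [Real.dist_eq]
      refine hqs.trans_lt (lt_of_le_of_lt ?_ hr2)
      refine le_mul_of_one_le_right (abs_nonneg _) ?_
      have : 0 ≤ C * (2 + ‖x‖ + s * ‖z‖) + ‖z‖ := by positivity
      linarith
    have := hvδ h5
    rw [dist_eq_norm] at this
    exact this.le
  -- Subtracting uniform motion with velocity `v s x` leaves a curve of speed at most `ε`; the mean
  -- value inequality is then the little-o estimate.
  have hmv := (convex_uIcc r s).norm_image_sub_le_of_norm_hasDerivWithin_le
    (f := fun q => φ r q x' - q • v s x) (f' := fun q => v q (φ r q x') - v s x) (C := ε)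
    (fun q hq => by
      have hq0 : 0 < q := (lt_min hr0 hs).trans_le hq.1
      have h := (hφ.hasDerivAt r x' hr0 q hq0).sub ((hasDerivAt_id q).smul_const (v s x))
      rw [one_smul] at h
      exact h.hasDerivWithinAt) hnear left_mem_uIcc right_mem_uIcc
  rw [hφ.self r x' hr0] at hmv
  have hval : φ r s x' - s • v s x - (x' - r • v s x) =
      φ r s (x + (r - s) • z) - φ s s (x + (s - s) • z) - (r - s) • (z - v s x) := by
    rw [sub_self, zero_smul, add_zero, hφ.self s x hs, hx', smul_sub, sub_smul r s (v s x)]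
    abel
  rw [hval, Real.norm_eq_abs, abs_sub_comm] at hmv
  rw [Real.norm_eq_abs]
  exact hmv

end IsFlow

end ODE

/-! ### The velocity as a posterior mean, its regularity and growth. -/

section Drift

variable {d : ℕ}

/-- The unnormalised standard Gaussian density. -/
noncomputable def bump (z : E d) : ℝ := Real.exp (-(‖z‖ ^ 2 / 2))

theorem bump_pos (z : E d) : 0 < bump z := Real.exp_pos _

theorem bump_le_one (z : E d) : bump z ≤ 1 :=
  Real.exp_le_one_iff.2 (neg_nonpos.2 (by positivity))

theorem continuous_bump : Continuous (bump : E d → ℝ) := by unfold bump; fun_prop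

/-- For `r > M ≥ 1` the excess `r - M` is at most `exp ((r² - M²) / 2)`, the factor that turns `exp
(-r²/2)` into `exp (-M²/2)`. Noise larger than `M` thus costs at most a fixed Gaussian tail. -/
theorem mul_exp_neg_sq_le {M r : ℝ} (hM : 1 ≤ M) :
    Real.exp (-(r ^ 2 / 2)) * r ≤ M * Real.exp (-(r ^ 2 / 2)) + Real.exp (-(M ^ 2 / 2)) := by
  by_cases hrM : r ≤ M
  · have := Real.exp_pos (-(r ^ 2 / 2))
    have := Real.exp_pos (-(M ^ 2 / 2))
    nlinarith
  · have h1 : Real.exp (-(M ^ 2 / 2)) =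
        Real.exp (-(r ^ 2 / 2)) * Real.exp ((r ^ 2 - M ^ 2) / 2) := by
      rw [← Real.exp_add]; ring_nf
    have h2 := Real.add_one_le_exp ((r ^ 2 - M ^ 2) / 2)
    have h3 : r ≤ M + Real.exp ((r ^ 2 - M ^ 2) / 2) := by nlinarith
    rw [h1]
    nlinarith [Real.exp_pos (-(r ^ 2 / 2))]

theorem norm_bump_smul (z : E d) : ‖bump z • z‖ = Real.exp (-(‖z‖ ^ 2 / 2)) * ‖z‖ := by
  rw [norm_smul, Real.norm_of_nonneg (bump_pos z).le, bump]

theorem norm_bump_smul_le (z : E d) : ‖bump z • z‖ ≤ 1 := by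
  rw [norm_bump_smul, Real.exp_neg, ← div_eq_inv_mul, div_le_one (Real.exp_pos _)]
  nlinarith [Real.add_one_le_exp (‖z‖ ^ 2 / 2), sq_nonneg (‖z‖ - 1)]

theorem bump_mul_sq_le (z : E d) : bump z * ‖z‖ ^ 2 ≤ 2 := by
  rw [bump, Real.exp_neg, ← div_eq_inv_mul, div_le_iff₀ (Real.exp_pos _)]
  nlinarith [Real.add_one_le_exp (‖z‖ ^ 2 / 2)]

theorem hasFDerivAt_bump (z : E d) :
    HasFDerivAt (bump : E d → ℝ) (-(innerSL ℝ (bump z • z))) z := by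
  have h := (((hasStrictFDerivAt_norm_sq z).hasFDerivAt.const_mul (2⁻¹ : ℝ)).neg).exp
  have he : (fun z : E d => Real.exp (-(2⁻¹ * ‖z‖ ^ 2))) = bump := by
    funext w; rw [bump]; congr 1; ring
  have hz : Real.exp (-(2⁻¹ * ‖z‖ ^ 2)) = bump z := congrFun he z
  simp only [Pi.neg_apply] at h
  rw [he, hz] at h
  refine h.congr_fderiv ?_
  ext w
  simp

theorem hasFDerivAt_bump_smul (z : E d) :
    HasFDerivAt (fun z : E d => bump z • z)
      (bump z • ContinuousLinearMap.id ℝ (E d) + (-(innerSL ℝ (bump z • z))).smulRight z) z :=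
  (hasFDerivAt_bump z).smul (hasFDerivAt_id z)

theorem lipschitzWith_bump : LipschitzWith 1 (bump : E d → ℝ) := by
  refine lipschitzWith_of_nnnorm_fderiv_le (𝕜 := ℝ)
    (fun z => (hasFDerivAt_bump z).differentiableAt) fun z => ?_
  rw [(hasFDerivAt_bump z).fderiv, ← NNReal.coe_le_coe, coe_nnnorm, norm_neg, innerSL_apply_norm]
  exact norm_bump_smul_le z

theorem lipschitzWith_bump_smul : LipschitzWith 3 (fun z : E d => bump z • z) := by
  refine lipschitzWith_of_nnnorm_fderiv_le (𝕜 := ℝ)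
    (fun z => (hasFDerivAt_bump_smul z).differentiableAt) fun z => ?_
  rw [(hasFDerivAt_bump_smul z).fderiv, ← NNReal.coe_le_coe, coe_nnnorm]
  refine (norm_add_le _ _).trans ?_
  rw [ContinuousLinearMap.norm_smulRight_apply, norm_neg, innerSL_apply_norm, norm_smul,
    norm_smul, Real.norm_of_nonneg (bump_pos z).le]
  have h1 : bump z * ‖ContinuousLinearMap.id ℝ (E d)‖ ≤ 1 * 1 :=
    mul_le_mul (bump_le_one z) ContinuousLinearMap.norm_id_le (norm_nonneg _) zero_le_one
  have h2 := bump_mul_sq_le z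
  have h3 : ((3 : ℝ≥0) : ℝ) = 3 := rfl
  rw [h3]
  nlinarith

/-- The density of `p_t` up to the Gaussian normalising constant. -/
noncomputable def mass (p : Measure (E d)) (t : ℝ) (x : E d) : ℝ :=
  ∫ y, bump (t⁻¹ • (x - y)) ∂p

/-- The mean of the noise against the unnormalised posterior. -/
noncomputable def moment (p : Measure (E d)) (t : ℝ) (x : E d) : E d :=
  ∫ y, bump (t⁻¹ • (x - y)) • (t⁻¹ • (x - y)) ∂p

/-- The velocity field `-t ∇ log p_t` of the probability-flow ODE, as the posterior mean of the
noise; see `smul_score`. -/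
noncomputable def drift (p : Measure (E d)) (t : ℝ) (x : E d) : E d :=
  (mass p t x)⁻¹ • moment p t x

/-- The normalising constant of `N(0, t² I)`. -/
noncomputable def normConst (d : ℕ) (t : ℝ) : ℝ := ((2 * Real.pi * t ^ 2) ^ ((d : ℝ) / 2))⁻¹

theorem normConst_pos {t : ℝ} (ht : 0 < t) : 0 < normConst d t := by
  unfold normConst; positivity

theorem noiseDensity_eq {t : ℝ} (ht : 0 < t) (z : E d) :
    noiseDensity d t z = normConst d t * bump (t⁻¹ • z) := by
  rw [noiseDensity, normConst, bump, norm_smul, norm_inv, Real.norm_of_nonneg ht.le]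
  congr 3
  field_simp

theorem forwardDensity_eq (p : Measure (E d)) {t : ℝ} (ht : 0 < t) (x : E d) :
    forwardDensity p t x = normConst d t * mass p t x := by
  simp_rw [forwardDensity, noiseDensity_eq ht, mass]
  rw [integral_const_mul]

variable (p : Measure (E d)) [IsProbabilityMeasure p]

theorem integrable_bump (t : ℝ) (x : E d) :
    Integrable (fun y => bump (t⁻¹ • (x - y))) p := by
  refine Integrable.of_bound (C := 1)
    ((continuous_bump.comp (by fun_prop)).aestronglyMeasurable) (ae_of_all _ fun y => ?_)
  rw [Real.norm_of_nonneg (bump_pos _).le]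
  exact bump_le_one _

theorem continuous_bump_smul : Continuous (fun z : E d => bump z • z) :=
  continuous_bump.smul continuous_id

theorem integrable_bump_smul (t : ℝ) (x : E d) :
    Integrable (fun y => bump (t⁻¹ • (x - y)) • (t⁻¹ • (x - y))) p := by
  refine Integrable.of_bound (C := 1)
    ((continuous_bump_smul.comp (f := fun y => t⁻¹ • (x - y)) (by fun_prop)).aestronglyMeasurable)
    (ae_of_all _ fun y => norm_bump_smul_le _)

theorem exists_half_le_closedBall : ∃ R : ℝ, 0 ≤ R ∧ 1 / 2 ≤ p.real (closedBall 0 R) := by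
  have h : Tendsto (fun n : ℕ => p (closedBall (0 : E d) n)) atTop (𝓝 (p (⋃ n : ℕ, closedBall 0 n))) :=
    tendsto_measure_iUnion_atTop fun m n hmn => closedBall_subset_closedBall (by exact_mod_cast hmn)
  rw [iUnion_closedBall_nat, measure_univ] at h
  obtain ⟨n, hn⟩ := (h.eventually (lt_mem_nhds (show (1 / 2 : ℝ≥0∞) < 1 by
    rw [one_div]; exact ENNReal.one_half_lt_one))).exists
  refine ⟨n, n.cast_nonneg, ?_⟩
  rw [measureReal_def]
  have := (ENNReal.toReal_lt_toReal (by simp) (by simp)).2 hn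
  simpa using this.le

/-- Points of the ball lie within `‖x‖ + R` of `x`, and they carry at least half of `p`. This lower
bound controls the drift and, later, the density ratio at time `T`. -/
theorem half_exp_le_mass {R t : ℝ} (hR : 1 / 2 ≤ p.real (closedBall 0 R)) (ht : 0 < t)
    (x : E d) : 1 / 2 * Real.exp (-(((‖x‖ + R) / t) ^ 2 / 2)) ≤ mass p t x := by
  have h1 : ∫ y, (closedBall (0 : E d) R).indicator
      (fun _ => Real.exp (-(((‖x‖ + R) / t) ^ 2 / 2))) y ∂p ≤ mass p t x := by
    refine integral_mono ((integrable_const _).indicator measurableSet_closedBall)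
      (integrable_bump p t x) fun y => ?_
    by_cases hy : y ∈ closedBall (0 : E d) R
    · rw [indicator_of_mem hy, bump, norm_smul, norm_inv, Real.norm_of_nonneg ht.le,
        ← div_eq_inv_mul]
      gcongr
      exact (norm_sub_le _ _).trans (by gcongr; exact mem_closedBall_zero_iff.1 hy)
    · rw [indicator_of_notMem hy]; exact (bump_pos _).le
  rw [integral_indicator_const _ measurableSet_closedBall, smul_eq_mul] at h1
  exact (mul_le_mul_of_nonneg_right hR (Real.exp_pos _).le).trans h1

theorem mass_pos {t : ℝ} (ht : 0 < t) (x : E d) : 0 < mass p t x := by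
  obtain ⟨R, -, hR⟩ := exists_half_le_closedBall p
  exact lt_of_lt_of_le (by positivity) (half_exp_le_mass p hR ht x)

/-- No moment of `p` is needed: the Gaussian weights suppress distant data points. -/
theorem norm_drift_le {R t : ℝ} (hR0 : 0 ≤ R) (hR : 1 / 2 ≤ p.real (closedBall 0 R))
    (ht : 0 < t) (x : E d) : ‖drift p t x‖ ≤ (‖x‖ + R) / t + 3 := by
  -- The radius from `half_exp_le_mass`, plus one to ensure `1 ≤ M`. The tail `exp (-M²/2)` is then
  -- at most twice the mass, so the posterior mean is at most `M + 2`.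
  set M : ℝ := (‖x‖ + R) / t + 1 with hM
  have hM1 : 1 ≤ M := by rw [hM]; linarith [show 0 ≤ (‖x‖ + R) / t by positivity]
  have hm := mass_pos p ht x
  have h1 : ‖moment p t x‖ ≤ M * mass p t x + Real.exp (-(M ^ 2 / 2)) := by
    refine (norm_integral_le_integral_norm _).trans ?_
    have : ∫ y, (M * bump (t⁻¹ • (x - y)) + Real.exp (-(M ^ 2 / 2))) ∂p =
        M * mass p t x + Real.exp (-(M ^ 2 / 2)) := by
      rw [integral_add ((integrable_bump p t x).const_mul M) (integrable_const _),
        integral_const_mul, mass]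
      simp
    rw [← this]
    refine integral_mono (integrable_bump_smul p t x).norm
      (((integrable_bump p t x).const_mul M).add (integrable_const _)) fun y => ?_
    simp only [norm_bump_smul]
    exact mul_exp_neg_sq_le hM1
  have h2 : Real.exp (-(M ^ 2 / 2)) ≤ 2 * mass p t x := by
    have h3 := half_exp_le_mass p hR ht x
    have h4 : Real.exp (-(M ^ 2 / 2)) ≤ Real.exp (-(((‖x‖ + R) / t) ^ 2 / 2)) := by
      have : 0 ≤ (‖x‖ + R) / t := by positivity
      gcongr
      linarith
    linarith
  rw [drift, norm_smul, norm_inv, Real.norm_of_nonneg hm.le, ← div_eq_inv_mul, div_le_iff₀ hm]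
  nlinarith

theorem continuousOn_mass :
    ContinuousOn (fun z : ℝ × E d => mass p z.1 z.2) (Ioi 0 ×ˢ univ) := by
  refine continuousOn_of_dominated (bound := fun _ => 1)
    (fun z _ => (integrable_bump p z.1 z.2).aestronglyMeasurable)
    (fun z _ => ae_of_all _ fun y => ?_) (integrable_const _) (ae_of_all _ fun y => ?_)
  · rw [Real.norm_of_nonneg (bump_pos _).le]; exact bump_le_one _
  · refine continuous_bump.comp_continuousOn ?_
    exact (continuousOn_fst.inv₀ fun z hz => (ne_of_gt hz.1)).smul (by fun_prop)

theorem continuousOn_moment :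
    ContinuousOn (fun z : ℝ × E d => moment p z.1 z.2) (Ioi 0 ×ˢ univ) := by
  refine continuousOn_of_dominated (bound := fun _ => 1)
    (fun z _ => (integrable_bump_smul p z.1 z.2).aestronglyMeasurable)
    (fun z _ => ae_of_all _ fun y => norm_bump_smul_le _) (integrable_const _)
    (ae_of_all _ fun y => ?_)
  refine continuous_bump_smul.comp_continuousOn (f := fun z : ℝ × E d => z.1⁻¹ • (z.2 - y)) ?_
  exact (continuousOn_fst.inv₀ fun z hz => (ne_of_gt hz.1)).smul (by fun_prop)

theorem norm_integral_translate_sub_le {G : Type*} [NormedAddCommGroup G] [NormedSpace ℝ G]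
    {f : E d → G} {L : ℝ≥0} (hf : LipschitzWith L f) {t : ℝ} (ht : 0 < t)
    (hint : ∀ x, Integrable (fun y => f (t⁻¹ • (x - y))) p) (x x' : E d) :
    ‖∫ y, f (t⁻¹ • (x - y)) ∂p - ∫ y, f (t⁻¹ • (x' - y)) ∂p‖ ≤ L * t⁻¹ * ‖x - x'‖ := by
  rw [← integral_sub (hint x) (hint x')]
  have h := norm_integral_le_of_norm_le_const (μ := p) (C := L * t⁻¹ * ‖x - x'‖)
    (f := fun y => f (t⁻¹ • (x - y)) - f (t⁻¹ • (x' - y))) (ae_of_all _ fun y => ?_)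
  · simpa using h
  · refine (hf.norm_sub_le _ _).trans_eq ?_
    rw [← smul_sub, sub_sub_sub_cancel_right, norm_smul, norm_inv, Real.norm_of_nonneg ht.le,
      mul_assoc]

theorem isTameField_drift : IsTameField (drift p) := by
  obtain ⟨R, hR0, hR⟩ := exists_half_le_closedBall p
  refine ⟨?_, fun a b R' ha => ?_, fun a ha => ?_⟩
  · exact ((continuousOn_mass p).inv₀ fun z hz => (mass_pos p hz.1 z.2).ne').smul
      (continuousOn_moment p)
  -- `r` guards against a negative radius; on the ball and for times in `[a, b]`, `m` bounds the
  -- mass from below and `G` the drift from above.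
  · set r : ℝ := max R' 0
    set m : ℝ := 1 / 2 * Real.exp (-(((r + R) / a) ^ 2 / 2)) with hm
    set G : ℝ := (r + R) / a + 3 with hG
    have hr0 : 0 ≤ r := le_max_right _ _
    have hm0 : 0 < m := by positivity
    have hG0 : 0 ≤ G := by positivity
    refine ⟨⟨(3 + G) / (a * m), by positivity⟩, fun t ht => LipschitzOnWith.of_dist_le_mul ?_⟩
    intro x hx y hy
    have ht0 : 0 < t := ha.trans_le ht.1
    have hxr : ‖x‖ ≤ r := (mem_closedBall_zero_iff.1 hx).trans (le_max_left _ _)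
    have hyr : ‖y‖ ≤ r := (mem_closedBall_zero_iff.1 hy).trans (le_max_left _ _)
    have hQx : m ≤ mass p t x := by
      refine le_trans ?_ (half_exp_le_mass p hR ht0 x)
      rw [hm]
      have : (‖x‖ + R) / t ≤ (r + R) / a := by gcongr; exact ht.1
      gcongr
    have hvy : ‖drift p t y‖ ≤ G := by
      refine (norm_drift_le p hR0 hR ht0 y).trans ?_
      rw [hG]
      gcongr
      exact ht.1
    have hQ0 := mass_pos p ht0 x
    have hQy := mass_pos p ht0 y
    have hta : t⁻¹ ≤ a⁻¹ := inv_anti₀ ha ht.1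
    have hV : ‖moment p t x - moment p t y‖ ≤ 3 * a⁻¹ * ‖x - y‖ := by
      have := norm_integral_translate_sub_le p lipschitzWith_bump_smul ht0
        (integrable_bump_smul p t) x y
      refine this.trans ?_
      have h3 : ((3 : ℝ≥0) : ℝ) = 3 := rfl
      rw [h3]
      gcongr
    have hQ : |mass p t y - mass p t x| ≤ a⁻¹ * ‖x - y‖ := by
      have := norm_integral_translate_sub_le p lipschitzWith_bump ht0 (integrable_bump p t) y x
      rw [NNReal.coe_one, one_mul, norm_sub_rev y x] at this
      refine this.trans ?_
      gcongr
    have hdec : drift p t x - drift p t y = (mass p t x)⁻¹ • ((moment p t x - moment p t y) +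
        (mass p t y - mass p t x) • drift p t y) := by
      have h1 : mass p t y • drift p t y = moment p t y := by
        rw [drift, smul_inv_smul₀ hQy.ne']
      rw [sub_smul, h1, smul_add, smul_sub, smul_sub, inv_smul_smul₀ hQ0.ne']
      rw [← drift]
      abel
    rw [dist_eq_norm, dist_eq_norm, hdec, norm_smul, norm_inv, Real.norm_of_nonneg hQ0.le]
    change (mass p t x)⁻¹ * _ ≤ (3 + G) / (a * m) * ‖x - y‖
    have h5 : ‖(moment p t x - moment p t y) + (mass p t y - mass p t x) • drift p t y‖ ≤
        (3 + G) * a⁻¹ * ‖x - y‖ := by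
      refine (norm_add_le _ _).trans ?_
      rw [norm_smul, Real.norm_eq_abs]
      have := mul_le_mul hQ hvy (norm_nonneg _) (by positivity)
      linarith
    calc (mass p t x)⁻¹ * _ ≤ m⁻¹ * ((3 + G) * a⁻¹ * ‖x - y‖) := by gcongr
      _ = (3 + G) / (a * m) * ‖x - y‖ := by rw [div_eq_mul_inv, mul_inv]; ring
  · refine ⟨(1 + R) / a + 3, by positivity, fun t ht x => ?_⟩
    refine (norm_drift_le p hR0 hR (ha.trans_le ht) x).trans ?_
    have h1 : (‖x‖ + R) / t ≤ (‖x‖ + R) / a := by gcongr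
    have h2 : (‖x‖ + R) / a ≤ (1 + R) * (1 + ‖x‖) / a := by
      gcongr
      nlinarith [norm_nonneg x, mul_nonneg hR0 (norm_nonneg x)]
    have h3 : (1 + R) * (1 + ‖x‖) / a = (1 + R) / a * (1 + ‖x‖) := by ring
    nlinarith [norm_nonneg x]

theorem hasFDerivAt_mass {t : ℝ} (ht : 0 < t) (x : E d) :
    HasFDerivAt (mass p t) (-(t⁻¹ • innerSL ℝ (moment p t x))) x := by
  have hz : ∀ y x' : E d, HasFDerivAt (fun x => bump (t⁻¹ • (x - y)))
      (-(t⁻¹ • innerSL ℝ (bump (t⁻¹ • (x' - y)) • (t⁻¹ • (x' - y))))) x' := by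
    intro y x'
    have h1 : HasFDerivAt (fun x : E d => t⁻¹ • (x - y))
        (t⁻¹ • ContinuousLinearMap.id ℝ (E d)) x' :=
      ((hasFDerivAt_id x').sub_const y).const_smul t⁻¹
    refine ((hasFDerivAt_bump _).comp x' h1).congr_fderiv ?_
    ext w
    simp
  have hmeas : Continuous (fun y => bump (t⁻¹ • (x - y)) • (t⁻¹ • (x - y))) :=
    continuous_bump_smul.comp (f := fun y => t⁻¹ • (x - y)) (by fun_prop)
  have h := hasFDerivAt_integral_of_dominated_of_fderiv_le (μ := p) (s := univ)
    (F := fun x y => bump (t⁻¹ • (x - y))) (x₀ := x) (bound := fun _ => t⁻¹)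
    (F' := fun x' y => -(t⁻¹ • innerSL ℝ (bump (t⁻¹ • (x' - y)) • (t⁻¹ • (x' - y)))))
    univ_mem (Eventually.of_forall fun x' => (integrable_bump p t x').aestronglyMeasurable)
    (integrable_bump p t x)
    (by
      refine Continuous.aestronglyMeasurable ?_
      exact (((innerSL ℝ).continuous.comp hmeas).const_smul t⁻¹).neg)
    (ae_of_all _ fun y x' _ => by
      rw [norm_neg, norm_smul, norm_inv, Real.norm_of_nonneg ht.le, innerSL_apply_norm]
      exact mul_le_of_le_one_right (by positivity) (norm_bump_smul_le _))
    (integrable_const _) (ae_of_all _ fun y x' _ => hz y x')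
  refine h.congr_fderiv ?_
  rw [integral_neg, integral_smul, moment,
    ContinuousLinearMap.integral_comp_comm (innerSL ℝ) (integrable_bump_smul p t x)]

/-- Tweedie's formula: the normalising constant does not depend on `x` and drops out of the
logarithmic derivative. -/
theorem smul_score {t : ℝ} (ht : 0 < t) (x : E d) : t • score p t x = -drift p t x := by
  have hm := mass_pos p ht x
  have hc := normConst_pos (d := d) ht
  have h : HasGradientAt (fun z => Real.log (forwardDensity p t z))
      (-(t⁻¹ • drift p t x)) x := by
    rw [hasGradientAt_iff_hasFDerivAt]
    have h1 := ((hasFDerivAt_mass p ht x).const_mul (normConst d t)).log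
      (mul_pos hc hm).ne'
    simp_rw [forwardDensity_eq p ht]
    refine h1.congr_fderiv ?_
    ext w
    simp [drift]
    field_simp
  rw [score, h.gradient, smul_neg, smul_inv_smul₀ ht.ne']

end Drift

/-! ### The conditional-mean property of the drift and its fourth moment. -/

section Posterior

variable {d : ℕ}

theorem measurable_drift (p : Measure (E d)) [IsProbabilityMeasure p] :
    Measurable (fun z : ℝ × E d => drift p z.1 z.2) := by
  have h1 : Measurable fun w : (ℝ × E d) × E d => w.1.1⁻¹ • (w.1.2 - w.2) := by fun_prop
  have h2 : StronglyMeasurable (fun z : ℝ × E d => mass p z.1 z.2) :=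
    StronglyMeasurable.integral_prod_right'
      (f := fun w : (ℝ × E d) × E d => bump (w.1.1⁻¹ • (w.1.2 - w.2)))
      (continuous_bump.measurable.comp h1).stronglyMeasurable
  have h3 : StronglyMeasurable (fun z : ℝ × E d => moment p z.1 z.2) :=
    StronglyMeasurable.integral_prod_right'
      (f := fun w : (ℝ × E d) × E d => bump (w.1.1⁻¹ • (w.1.2 - w.2)) • (w.1.1⁻¹ • (w.1.2 - w.2)))
      (continuous_bump_smul.measurable.comp h1).stronglyMeasurable
  exact h2.measurable.inv.smul h3.measurable

theorem measurable_drift_apply (p : Measure (E d)) [IsProbabilityMeasure p] (t : ℝ) :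
    Measurable (drift p t) := by
  have h : Measurable fun x : E d => (t, x) := by fun_prop
  have h2 := (measurable_drift p).comp h
  exact h2

instance isProbabilityMeasure_noise (t : ℝ) : IsProbabilityMeasure (noise d t) :=
  Measure.isProbabilityMeasure_map (by fun_prop)

instance isProbabilityMeasure_forwardLaw (p : Measure (E d)) [IsProbabilityMeasure p] (t : ℝ) :
    IsProbabilityMeasure (forwardLaw p t) := by
  unfold forwardLaw; infer_instance

theorem measurable_ofReal_noiseDensity (t : ℝ) :
    Measurable fun w : E d × E d => ENNReal.ofReal (noiseDensity d t (w.2 - w.1)) :=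
  ((continuous_noiseDensity d t).measurable.comp (by fun_prop)).ennreal_ofReal

variable (p : Measure (E d)) [IsProbabilityMeasure p]

/-- This couples all times on one product space, where `x_t = x_0 + t z` has velocity `z` in `t`.
Only one-time marginals of the forward process matter. -/
theorem forwardLaw_eq_map (t : ℝ) :
    forwardLaw p t = (p.prod (stdGaussian (E d))).map (fun ω => ω.1 + t • ω.2) := by
  have h := Measure.map_prod_map p (stdGaussian (E d)) measurable_id
    (show Measurable fun z : E d => t • z by fun_prop)
  rw [Measure.map_id] at h
  rw [forwardLaw, Measure.conv, noise, h, Measure.map_map (by fun_prop) (by fun_prop)]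
  rfl

/-- The joint law of the clean and the noised point. -/
theorem map_prod_stdGaussian (p : Measure (E d)) [SFinite p] {t : ℝ} (ht : 0 < t) :
    (p.prod (stdGaussian (E d))).map (fun ω => (ω.1, ω.1 + t • ω.2)) =
      (p.prod volume).withDensity
        (fun w => ENNReal.ofReal (noiseDensity d t (w.2 - w.1))) := by
  refine Measure.ext_of_lintegral _ fun f hf => ?_
  have hm := measurable_ofReal_noiseDensity (d := d) t
  rw [lintegral_map hf (by fun_prop), lintegral_prod _ (by fun_prop),
    lintegral_withDensity_eq_lintegral_mul _ hm hf,
    lintegral_prod _ (hm.mul hf).aemeasurable]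
  refine lintegral_congr fun y => ?_
  have hfy : Measurable fun z : E d => f (y, y + z) := by fun_prop
  have h1 : ∫⁻ z, f (y, y + t • z) ∂(stdGaussian (E d)) = ∫⁻ z, f (y, y + z) ∂(noise d t) := by
    rw [noise, lintegral_map hfy (by fun_prop)]
  have hn : Measurable fun z : E d => ENNReal.ofReal (noiseDensity d t z) :=
    (continuous_noiseDensity d t).measurable.ennreal_ofReal
  rw [h1, noise_eq_withDensity d ht, lintegral_withDensity_eq_lintegral_mul _ hn hfy,
    ← lintegral_add_left_eq_self (fun x => ((fun w : E d × E d =>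
      ENNReal.ofReal (noiseDensity d t (w.2 - w.1))) * f) (y, x)) y]
  simp

/-- The drift is the conditional mean of the noise given the noised point. -/
theorem integral_noise_sub_drift_eq_zero {t : ℝ} (ht : 0 < t) {g : E d → E d →L[ℝ] ℝ}
    (hg : Measurable g)
    (hint : Integrable (fun ω : E d × E d =>
      g (ω.1 + t • ω.2) (ω.2 - drift p t (ω.1 + t • ω.2))) (p.prod (stdGaussian (E d)))) :
    ∫ ω : E d × E d, g (ω.1 + t • ω.2) (ω.2 - drift p t (ω.1 + t • ω.2))
      ∂(p.prod (stdGaussian (E d))) = 0 := by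
  set h : E d × E d → ℝ := fun w => g w.2 (t⁻¹ • (w.2 - w.1) - drift p t w.2) with hh
  have hdr : Measurable (drift p t) := measurable_drift_apply p t
  have hhm : Measurable h := by
    have h1 : Measurable fun w : E d × E d => t⁻¹ • (w.2 - w.1) - drift p t w.2 :=
      (by fun_prop : Measurable fun w : E d × E d => t⁻¹ • (w.2 - w.1)).sub
        (hdr.comp measurable_snd)
    exact (continuous_fst.clm_apply continuous_snd).measurable.comp
      ((hg.comp measurable_snd).prodMk h1)
  have hmap : Measurable fun ω : E d × E d => (ω.1, ω.1 + t • ω.2) := by fun_prop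
  have hcomp : (fun ω : E d × E d => g (ω.1 + t • ω.2) (ω.2 - drift p t (ω.1 + t • ω.2))) =
      h ∘ fun ω => (ω.1, ω.1 + t • ω.2) := by
    funext ω
    simp only [hh, Function.comp_apply, add_sub_cancel_left, inv_smul_smul₀ ht.ne']
  have hden := measurable_ofReal_noiseDensity (d := d) t
  have hlt : ∀ᵐ w : E d × E d ∂(p.prod volume),
      ENNReal.ofReal (noiseDensity d t (w.2 - w.1)) < ∞ := ae_of_all _ fun w => by simp
  rw [hcomp] at hint ⊢
  have hint' := (integrable_map_measure hhm.aestronglyMeasurable hmap.aemeasurable).2 hint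
  simp only [Function.comp_def]
  rw [← integral_map hmap.aemeasurable hhm.aestronglyMeasurable]
  rw [map_prod_stdGaussian p ht] at hint' ⊢
  rw [integrable_withDensity_iff_integrable_smul' hden hlt] at hint'
  -- Integrating over the clean point first, at fixed noised point `x`, leaves a multiple of `g x
  -- (moment - mass • drift)`, which is zero by definition of the drift.
  rw [integral_withDensity_eq_integral_toReal_smul hden hlt, integral_prod_symm _ hint']
  refine integral_eq_zero_of_ae (ae_of_all _ fun x => ?_)
  have hval : ∀ y, (ENNReal.ofReal (noiseDensity d t (x - y))).toReal • h (y, x) =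
      normConst d t * g x (bump (t⁻¹ • (x - y)) • (t⁻¹ • (x - y)) -
        bump (t⁻¹ • (x - y)) • drift p t x) := by
    intro y
    rw [ENNReal.toReal_ofReal (noiseDensity_nonneg d t _), noiseDensity_eq ht, hh, ← smul_sub,
      map_smul, smul_eq_mul, smul_eq_mul, mul_assoc]
  simp only [hval, Pi.zero_apply]
  have hi1 := integrable_bump_smul p t x
  have hi2 : Integrable (fun y => bump (t⁻¹ • (x - y)) • drift p t x) p :=
    (integrable_bump p t x).smul_const _
  have hi3 : Integrable (fun y => bump (t⁻¹ • (x - y)) • (t⁻¹ • (x - y)) -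
      bump (t⁻¹ • (x - y)) • drift p t x) p := hi1.sub hi2
  rw [integral_const_mul, ContinuousLinearMap.integral_comp_comm (g x) hi3,
    integral_sub hi1 hi2, integral_smul_const]
  have : mass p t x • drift p t x = moment p t x := by
    rw [drift, smul_inv_smul₀ (mass_pos p ht x).ne']
  rw [← mass, this, ← moment, sub_self, map_zero, mul_zero]

theorem lintegral_pow_four_le {α : Type*} [MeasurableSpace α] (μ : Measure α) {f : α → ℝ≥0∞}
    (hf : AEMeasurable f μ) : (∫⁻ a, f a ∂μ) ^ 4 ≤ μ univ ^ 3 * ∫⁻ a, f a ^ 4 ∂μ := by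
  have hpq : (4 : ℝ).HolderConjugate (4 / 3) := by
    rw [Real.holderConjugate_iff]; norm_num
  have h := ENNReal.lintegral_mul_le_Lp_mul_Lq μ hpq hf (aemeasurable_const (b := (1 : ℝ≥0∞)))
  have h2 := pow_le_pow_left' h 4
  simp only [Pi.mul_apply, mul_one, ENNReal.one_rpow, lintegral_const, one_mul] at h2
  refine h2.trans_eq ?_
  rw [mul_pow, ← ENNReal.rpow_natCast, ← ENNReal.rpow_natCast, ← ENNReal.rpow_mul,
    ← ENNReal.rpow_mul, mul_comm, ← ENNReal.rpow_natCast (μ univ) 3]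
  norm_num

/-- Jensen's inequality for the posterior mean. -/
theorem mass_mul_drift_pow_four_le {t : ℝ} (ht : 0 < t) (x : E d) :
    ENNReal.ofReal (mass p t x) * ‖drift p t x‖ₑ ^ 4 ≤
      ∫⁻ y, ENNReal.ofReal (bump (t⁻¹ • (x - y))) * ‖t⁻¹ • (x - y)‖ₑ ^ 4 ∂p := by
  have hm := mass_pos p ht x
  set m : ℝ≥0∞ := ENNReal.ofReal (mass p t x) with hmdef
  have hm0 : m ≠ 0 := by rw [hmdef]; simpa using hm
  have hmt : m ≠ ∞ := ENNReal.ofReal_ne_top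
  have hw : Measurable fun y : E d => ENNReal.ofReal (bump (t⁻¹ • (x - y))) :=
    (continuous_bump.measurable.comp (by fun_prop)).ennreal_ofReal
  have hz : Measurable fun y : E d => ‖t⁻¹ • (x - y)‖ₑ := by fun_prop
  set μ := p.withDensity fun y => ENNReal.ofReal (bump (t⁻¹ • (x - y))) with hμ
  have huniv : μ univ = m := by
    rw [hμ, withDensity_apply _ MeasurableSet.univ, setLIntegral_univ, hmdef, mass,
      ofReal_integral_eq_lintegral_ofReal (integrable_bump p t x)
        (ae_of_all _ fun y => (bump_pos _).le)]
  have h1 : m * ‖drift p t x‖ₑ ≤ ∫⁻ y, ‖t⁻¹ • (x - y)‖ₑ ∂μ := by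
    have h2 : m * ‖drift p t x‖ₑ = ‖moment p t x‖ₑ := by
      have : mass p t x • drift p t x = moment p t x := by
        rw [drift, smul_inv_smul₀ hm.ne']
      rw [← this, enorm_smul, Real.enorm_of_nonneg hm.le]
    rw [h2, hμ, lintegral_withDensity_eq_lintegral_mul _ hw hz]
    refine (enorm_integral_le_lintegral_enorm _).trans_eq (lintegral_congr fun y => ?_)
    rw [enorm_smul, Real.enorm_of_nonneg (bump_pos _).le, Pi.mul_apply]
  -- `μ` has total mass `m`, so Hölder produces a factor `m ^ 3`, which cancels since `m` is neither
  -- zero nor infinite.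
  have h3 := (pow_le_pow_left' h1 4).trans (lintegral_pow_four_le μ hz.aemeasurable)
  rw [huniv, hμ, lintegral_withDensity_eq_lintegral_mul _ hw (hz.pow_const 4), mul_pow,
    show m ^ 4 = m ^ 3 * m by ring, mul_assoc] at h3
  exact (ENNReal.mul_le_mul_iff_right (pow_ne_zero 3 hm0) (ENNReal.pow_ne_top hmt)).1 h3

/-- The fourth moment of the velocity along the forward process is at most that of the noise. -/
theorem lintegral_drift_pow_four_le {t : ℝ} (ht : 0 < t) :
    ∫⁻ x, ‖drift p t x‖ₑ ^ 4 ∂(forwardLaw p t) ≤ ∫⁻ z, ‖z‖ₑ ^ 4 ∂(stdGaussian (E d)) := by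
  have hdr : Measurable (drift p t) := measurable_drift_apply p t
  have hfd : Measurable fun x => ENNReal.ofReal (forwardDensity p t x) := by
    simp_rw [forwardDensity_eq p ht]
    have : Continuous (mass p t) := continuous_iff_continuousAt.2 fun x =>
      (hasFDerivAt_mass p ht x).continuousAt
    fun_prop
  have hden := measurable_ofReal_noiseDensity (d := d) t
  have hmap : Measurable fun ω : E d × E d => (ω.1, ω.1 + t • ω.2) := by fun_prop
  have hf4 : Measurable fun w : E d × E d => ‖t⁻¹ • (w.2 - w.1)‖ₑ ^ 4 := by fun_prop
  have hrhs : ∫⁻ z, ‖z‖ₑ ^ 4 ∂(stdGaussian (E d)) =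
      ∫⁻ x, ∫⁻ y, ENNReal.ofReal (noiseDensity d t (x - y)) * ‖t⁻¹ • (x - y)‖ₑ ^ 4 ∂p := by
    have h1 : ∫⁻ z, ‖z‖ₑ ^ 4 ∂(stdGaussian (E d)) =
        ∫⁻ w : E d × E d, ‖t⁻¹ • (w.2 - w.1)‖ₑ ^ 4
          ∂((p.prod (stdGaussian (E d))).map (fun ω => (ω.1, ω.1 + t • ω.2))) := by
      rw [lintegral_map hf4 hmap]
      simp only [add_sub_cancel_left, inv_smul_smul₀ ht.ne']
      rw [lintegral_prod _ (by fun_prop)]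
      simp
    rw [h1, map_prod_stdGaussian p ht, lintegral_withDensity_eq_lintegral_mul _ hden hf4,
      lintegral_prod_symm' _ (hden.mul hf4)]
    rfl
  rw [hrhs, forwardLaw_eq_withDensity p ht,
    lintegral_withDensity_eq_lintegral_mul _ hfd (hdr.enorm.pow_const 4)]
  refine lintegral_mono fun x => ?_
  have hc := (normConst_pos (d := d) ht).le
  simp only [Pi.mul_apply]
  rw [forwardDensity_eq p ht, ENNReal.ofReal_mul hc, mul_assoc]
  simp_rw [noiseDensity_eq ht, ENNReal.ofReal_mul hc, mul_assoc]
  rw [lintegral_const_mul' _ _ ENNReal.ofReal_ne_top]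
  gcongr
  exact mass_mul_drift_pow_four_le p ht x

theorem lintegral_enorm_pow_four_stdGaussian_lt_top :
    ∫⁻ z, ‖z‖ₑ ^ 4 ∂(stdGaussian (E d)) < ∞ := by
  have h := (IsGaussian.memLp_id (stdGaussian (E d)) 4 (by simp)).eLpNorm_lt_top
  have h2 := lintegral_rpow_enorm_lt_top_of_eLpNorm_lt_top (by norm_num) (by simp) h
  simpa using h2

theorem integrable_norm_stdGaussian : Integrable (fun z => ‖z‖) (stdGaussian (E d)) :=
  (memLp_one_iff_integrable.1 (IsGaussian.memLp_id (stdGaussian (E d)) 1 (by simp))).norm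

theorem volume_absolutelyContinuous_noise {t : ℝ} (ht : 0 < t) :
    (volume : Measure (E d)) ≪ noise d t := by
  rw [noise_eq_withDensity d ht]
  refine withDensity_absolutelyContinuous'
    (continuous_noiseDensity d t).measurable.ennreal_ofReal.aemeasurable (ae_of_all _ fun z => ?_)
  rw [noiseDensity_eq ht]
  simpa using mul_pos (normConst_pos ht) (bump_pos _)

theorem noise_absolutelyContinuous_volume {t : ℝ} (ht : 0 < t) :
    noise d t ≪ (volume : Measure (E d)) := by
  rw [noise_eq_withDensity d ht]
  exact withDensity_absolutelyContinuous _ _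

theorem forwardLaw_absolutelyContinuous_volume {t : ℝ} (ht : 0 < t) :
    forwardLaw p t ≪ (volume : Measure (E d)) := by
  rw [forwardLaw_eq_withDensity p ht]
  exact withDensity_absolutelyContinuous _ _

end Posterior

/-! ### The flow transports the marginals of the forward process. -/

section Pushforward

/-- Differentiability is asked only at `x₀` for almost every `a`: Rademacher's theorem, applied
below at one fixed time, supplies no more. -/
theorem hasDerivAt_integral_of_norm_sub_le {α G : Type*} [MeasurableSpace α] {μ : Measure α}
    [NormedAddCommGroup G] [NormedSpace ℝ G] [CompleteSpace G] {f : ℝ → α → G} {f' : α → G}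
    {bound : α → ℝ} {x₀ : ℝ} {s : Set ℝ} (hs : s ∈ 𝓝 x₀)
    (hf_meas : ∀ x ∈ s, AEStronglyMeasurable (f x) μ) (hf_int : Integrable (f x₀) μ)
    (hf'_meas : AEStronglyMeasurable f' μ)
    (hle : ∀ᵐ a ∂μ, ∀ x ∈ s, ‖f x a - f x₀ a‖ ≤ bound a * ‖x - x₀‖)
    (bound_integrable : Integrable bound μ)
    (h_diff : ∀ᵐ a ∂μ, HasDerivAt (f · a) (f' a) x₀) :
    Integrable f' μ ∧ HasDerivAt (fun x => ∫ a, f x a ∂μ) (∫ a, f' a ∂μ) x₀ := by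
  set L : G →L[ℝ] ℝ →L[ℝ] G := ContinuousLinearMap.smulRightL ℝ ℝ G 1
  replace h_diff : ∀ᵐ a ∂μ, HasFDerivAt (f · a) (L (f' a)) x₀ :=
    h_diff.mono fun x hx => hx.hasFDerivAt
  have hm : AEStronglyMeasurable (L ∘ f') μ := L.continuous.comp_aestronglyMeasurable hf'_meas
  obtain ⟨hF'_int, key⟩ := hasFDerivAt_integral_of_dominated_loc_of_lip'
    hs hf_meas hf_int hm hle bound_integrable h_diff
  replace hF'_int : Integrable f' μ := by
    rw [← integrable_norm_iff hm] at hF'_int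
    simpa [L, (· ∘ ·), integrable_norm_iff hf'_meas] using! hF'_int
  refine ⟨hF'_int, ?_⟩
  simp_rw [hasDerivAt_iff_hasFDerivAt] at h_diff ⊢
  simpa only [(· ∘ ·), ContinuousLinearMap.integral_comp_comm _ hF'_int] using! key

variable {d : ℕ}

/-- Finite measures on `ℝᵈ` that agree on Lipschitz functions of bounded support are equal. -/
theorem measure_ext_of_lipschitz {μ ν : Measure (E d)} [IsFiniteMeasure μ] [IsFiniteMeasure ν]
    (h : ∀ (w : E d → ℝ) (L : ℝ≥0) (R : ℝ), LipschitzWith L w → (∀ x, |w x| ≤ 1) →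
      (∀ x, R < ‖x‖ → w x = 0) → ∫ x, w x ∂μ = ∫ x, w x ∂ν) : μ = ν := by
  apply Measure.OuterRegular.ext_isOpen
  apply Measure.InnerRegularWRT.eq_of_innerRegularWRT_of_forall_eq Measure.Regular.innerRegular
    Measure.Regular.innerRegular
  -- Compact sets determine the measures, and their indicators are limits of thickened indicators,
  -- which are Lipschitz of bounded support.
  intro K hK
  obtain ⟨R, hR⟩ := hK.isBounded.subset_closedBall 0
  have hpos : ∀ n : ℕ, (0 : ℝ) < 1 / ((n : ℝ) + 1) := fun n => Nat.one_div_pos_of_nat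
  have hlim := tendsto_one_div_add_atTop_nhds_zero_nat (𝕜 := ℝ)
  have h1 := tendsto_integral_thickenedIndicator_of_isClosed μ hK.isClosed hpos hlim
  have h2 := tendsto_integral_thickenedIndicator_of_isClosed ν hK.isClosed hpos hlim
  have heq : ∀ n : ℕ, ∫ x, (thickenedIndicator (hpos n) K x : ℝ) ∂μ =
      ∫ x, (thickenedIndicator (hpos n) K x : ℝ) ∂ν := by
    intro n
    refine h _ (1 / (1 / ((n : ℝ) + 1))).toNNReal (R + 1 / ((n : ℝ) + 1)) ?_ ?_ ?_
    · have hl := lipschitzWith_thickenedIndicator (hpos n) K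
      have := NNReal.isometry_coe.lipschitz.comp hl
      refine (LipschitzWith.of_dist_le_mul fun x y => ?_)
      have h4 := this.dist_le_mul x y
      simpa [Real.toNNReal_inv, hpos n] using h4
    · intro x
      rw [abs_of_nonneg (NNReal.coe_nonneg _)]
      exact_mod_cast thickenedIndicator_le_one (hpos n) K x
    · intro x hx
      rw [thickenedIndicator_zero (hpos n) K]
      · rfl
      · intro hmem
        obtain ⟨z, hz, hxz⟩ := mem_thickening_iff.1 hmem
        have hzR := mem_closedBall_zero_iff.1 (hR hz)
        rw [dist_eq_norm] at hxz
        have := norm_le_norm_add_norm_sub' x z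
        linarith
  simp_rw [heq] at h1
  have := tendsto_nhds_unique h1 h2
  exact (measureReal_eq_measureReal_iff).1 this

/-- Precomposition with a flow preserves Lipschitz functions of bounded support. -/
theorem IsFlow.exists_lipschitzWith_comp {F : Type*} [NormedAddCommGroup F] [NormedSpace ℝ F]
    {v : ℝ → F → F} {φ : ℝ → ℝ → F → F} (hφ : IsFlow v φ) (hv : IsTameField v) {s t : ℝ}
    (hs : 0 < s) (ht : 0 < t) {w : F → ℝ} {L : ℝ≥0} {R₀ : ℝ} (hw : LipschitzWith L w)
    (hw1 : ∀ x, |w x| ≤ 1) (hw0 : ∀ x, R₀ < ‖x‖ → w x = 0) :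
    ∃ (L' : ℝ≥0) (R : ℝ), 0 ≤ R ∧ LipschitzWith L' (fun x => w (φ s t x)) ∧
      ∀ x, R < ‖x‖ → w (φ s t x) = 0 := by
  obtain ⟨C, hC, hdisp⟩ := hφ.exists_norm_sub_le hv (lt_min hs ht) (b := max s t)
  set R₁ : ℝ := max R₀ 0
  have hR₁ : 0 ≤ R₁ := le_max_right _ _
  -- A point that flows into the ball of radius `R₁` is recovered by the reverse flow, whose
  -- displacement from there is at most the added term.
  set R : ℝ := R₁ + C * |s - t| * (1 + R₁) with hRdef
  have hR : 0 ≤ R := by positivity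
  have hzero : ∀ x, R < ‖x‖ → w (φ s t x) = 0 := by
    intro x hx
    refine hw0 _ ?_
    by_contra! hy
    have hy' : ‖φ s t x‖ ≤ R₁ := hy.trans (le_max_left _ _)
    have h := hdisp t ⟨min_le_right _ _, le_max_right _ _⟩ s ⟨min_le_left _ _, le_max_left _ _⟩
      (φ s t x)
    rw [hφ.comp hv hs ht hs, hφ.self s x hs] at h
    have h2 := norm_le_norm_add_norm_sub' x (φ s t x)
    have h3 : C * |s - t| * (1 + ‖φ s t x‖) ≤ C * |s - t| * (1 + R₁) := by gcongr
    linarith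
  obtain ⟨K, hK⟩ := hφ.exists_lipschitzOnWith hv hs ht (R + 1)
  -- Outside the ball of radius `R + 1` the constant `K` is not available; a separation of at least
  -- one lets `|w| ≤ 1` replace it.
  have hone : ∀ x y, ‖x‖ ≤ R → R + 1 < ‖y‖ →
      dist (w (φ s t x)) (w (φ s t y)) ≤ (L * K + 1 : ℝ≥0) * dist x y := by
    intro x y hx hy
    rw [hzero y (by linarith), dist_zero_right, Real.norm_eq_abs, dist_eq_norm]
    have h1 : 1 ≤ ‖x - y‖ := by
      have := norm_le_norm_add_norm_sub' y x
      rw [norm_sub_rev] at this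
      linarith
    refine (hw1 _).trans (h1.trans ?_)
    refine le_mul_of_one_le_left (norm_nonneg _) ?_
    push_cast
    linarith [mul_nonneg L.coe_nonneg K.coe_nonneg]
  refine ⟨L * K + 1, R, hR, LipschitzWith.of_dist_le_mul fun x y => ?_, hzero⟩
  by_cases hx : ‖x‖ ≤ R + 1
  · by_cases hy : ‖y‖ ≤ R + 1
    · have h1 := hw.dist_le_mul (φ s t x) (φ s t y)
      have h2 := hK.dist_le_mul x (mem_closedBall_zero_iff.2 hx) y (mem_closedBall_zero_iff.2 hy)
      push_cast
      have h3 := mul_le_mul_of_nonneg_left h2 L.coe_nonneg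
      have h4 : 0 ≤ dist x y := dist_nonneg
      nlinarith
    · by_cases hx' : ‖x‖ ≤ R
      · exact hone x y hx' (not_le.1 hy)
      · rw [hzero x (not_le.1 hx'), hzero y (by linarith [not_le.1 hy]), dist_self]
        positivity
  · by_cases hy : ‖y‖ ≤ R
    · rw [dist_comm, dist_comm x y]
      exact hone y x hy (not_le.1 hx)
    · rw [hzero y (not_le.1 hy), hzero x (by linarith [not_le.1 hx]), dist_self]
      positivity

variable (p : Measure (E d)) [IsProbabilityMeasure p]

/-- Transporting the forward process at time `s` along the flow of the drift to a fixed time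
does not depend on `s`, infinitesimally. -/
theorem hasDerivAt_integral_flow {φ : ℝ → ℝ → E d → E d} (hφ : IsFlow (drift p) φ) {s t : ℝ}
    (hs : 0 < s) (ht : 0 < t) {w : E d → ℝ} {L : ℝ≥0} {R₀ : ℝ} (hw : LipschitzWith L w)
    (hw1 : ∀ x, |w x| ≤ 1) (hw0 : ∀ x, R₀ < ‖x‖ → w x = 0) :
    HasDerivAt (fun r => ∫ ω : E d × E d, w (φ r t (ω.1 + r • ω.2))
      ∂(p.prod (stdGaussian (E d)))) 0 s := by
  have hv := isTameField_drift p
  obtain ⟨L', R, hR, hu, hu0⟩ := hφ.exists_lipschitzWith_comp hv hs ht hw hw1 hw0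
  set u : E d → ℝ := fun x => w (φ s t x) with hudef
  replace hu0 : ∀ x, R < ‖x‖ → u x = 0 := hu0
  obtain ⟨C, hC, hdisp⟩ := hφ.exists_norm_sub_le hv (a := s / 2) (b := 2 * s) (by positivity)
  have hsI : s ∈ Icc (s / 2) (2 * s) := ⟨by linarith, by linarith⟩
  have hnhds : Icc (s / 2) (2 * s) ∈ 𝓝 s := Icc_mem_nhds (by linarith) (by linarith)
  -- Factoring through time `s` freezes the test function as `u`; only the short motion from `r` to
  -- `s` still depends on `r`.
  have hflow : ∀ r ∈ Icc (s / 2) (2 * s), ∀ x, w (φ r t x) = u (φ r s x) := fun r hr x => by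
    rw [hudef]
    simp only
    rw [hφ.comp hv (by linarith [hr.1]) hs ht]
  have hcont : ∀ r ∈ Icc (s / 2) (2 * s),
      Continuous fun ω : E d × E d => u (φ r s (ω.1 + r • ω.2)) := fun r hr =>
    hu.continuous.comp ((hφ.continuous hv (by linarith [hr.1]) hs).comp (by fun_prop))
  have hgm : Measurable (fderiv ℝ u) := measurable_fderiv ℝ u
  have hY : Measurable fun ω : E d × E d => ω.1 + s • ω.2 := by fun_prop
  have hF'm : Measurable fun ω : E d × E d =>
      fderiv ℝ u (ω.1 + s • ω.2) (ω.2 - drift p s (ω.1 + s • ω.2)) :=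
    (continuous_fst.clm_apply continuous_snd).measurable.comp
      ((hgm.comp hY).prodMk (measurable_snd.sub ((measurable_drift_apply p s).comp hY)))
  have hzint : Integrable (fun ω : E d × E d => ‖ω.2‖) (p.prod (stdGaussian (E d))) :=
    integrable_norm_stdGaussian.comp_snd p
  have key := hasDerivAt_integral_of_norm_sub_le (μ := p.prod (stdGaussian (E d)))
    (f := fun r ω => u (φ r s (ω.1 + r • ω.2)))
    (f' := fun ω => fderiv ℝ u (ω.1 + s • ω.2) (ω.2 - drift p s (ω.1 + s • ω.2)))
    (bound := fun ω => L' * (C * (1 + R + s * ‖ω.2‖) + ‖ω.2‖)) hnhds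
    (fun r hr => (hcont r hr).aestronglyMeasurable)
    (Integrable.of_bound (C := 1) (hcont s hsI).aestronglyMeasurable
      (ae_of_all _ fun ω => hw1 _))
    hF'm.aestronglyMeasurable
    (ae_of_all _ fun ω r hr => by
      rw [hφ.self s _ hs]
      have hr0 : 0 < r := by linarith [hr.1]
      set x : E d := ω.1 + s • ω.2 with hx
      set x' : E d := ω.1 + r • ω.2 with hx'
      have hxx' : ‖x' - x‖ = |r - s| * ‖ω.2‖ := by
        rw [hx, hx', add_sub_add_left_eq_sub, ← sub_smul, norm_smul, Real.norm_eq_abs]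
      have hrs : |r - s| ≤ s := abs_le.2 ⟨by linarith [hr.1], by linarith [hr.2]⟩
      -- The increment vanishes unless `x` or `φ r s x'` lies in the ball of radius `R`. In either
      -- case the displacement is measured from a point of norm at most `R + s‖z‖`, so the bound
      -- needs no moment of `x_0`.
      by_cases hboth : R < ‖x‖ ∧ R < ‖φ r s x'‖
      · rw [hu0 x hboth.1, hu0 _ hboth.2, sub_zero, norm_zero]
        positivity
      · have hmove : ‖φ r s x' - x'‖ ≤ C * |r - s| * (1 + R + s * ‖ω.2‖) := by
          rw [not_and_or, not_lt, not_lt] at hboth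
          rcases hboth with hx1 | hx1
          · have h1 := hdisp r hr s hsI x'
            have h2 := norm_le_norm_add_norm_sub' x' x
            have h3 : |r - s| * ‖ω.2‖ ≤ s * ‖ω.2‖ := by gcongr
            have h4 : 1 + ‖x'‖ ≤ 1 + R + s * ‖ω.2‖ := by linarith
            rw [abs_sub_comm] at h1
            refine h1.trans ?_
            gcongr
          · have h1 := hdisp s hsI r hr (φ r s x')
            rw [hφ.comp hv hr0 hs hr0, hφ.self r x' hr0, norm_sub_rev] at h1
            have h4 : 1 + ‖φ r s x'‖ ≤ 1 + R + s * ‖ω.2‖ := by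
              have : 0 ≤ s * ‖ω.2‖ := by positivity
              linarith
            refine h1.trans ?_
            gcongr
        refine (hu.norm_sub_le _ _).trans ?_
        rw [mul_assoc, Real.norm_eq_abs]
        gcongr
        have h3 : φ r s x' - x = (φ r s x' - x') + (x' - x) := by abel
        rw [h3]
        refine (norm_add_le _ _).trans ?_
        rw [hxx']
        linarith)
    ((((integrable_const _).add (hzint.const_mul s)).const_mul C).add hzint |>.const_mul _)
    (by
      -- Rademacher's theorem, transferred to the law of `x_s` by absolute continuity.
      have hdiff : ∀ᵐ x ∂(forwardLaw p s), DifferentiableAt ℝ u x :=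
        (forwardLaw_absolutelyContinuous_volume p hs).ae_le hu.ae_differentiableAt
      rw [forwardLaw_eq_map] at hdiff
      filter_upwards [ae_of_ae_map hY.aemeasurable hdiff] with ω hω
      have h1 := hφ.hasDerivAt_diag hv hs (ω.1 + s • ω.2) ω.2
      have h2 : (fun r : ℝ => φ r s (ω.1 + s • ω.2 + (r - s) • ω.2)) =
          fun r : ℝ => φ r s (ω.1 + r • ω.2) := by
        funext r
        rw [sub_smul, add_assoc, add_sub_cancel]
      rw [h2] at h1
      exact hω.hasFDerivAt.comp_hasDerivAt_of_eq s h1 (hφ.self s _ hs).symm)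
  have hzero := integral_noise_sub_drift_eq_zero p hs hgm key.1
  rw [hzero] at key
  refine key.2.congr_of_eventuallyEq ?_
  filter_upwards [hnhds] with r hr
  simp only [hflow r hr]

/-- The flow of the probability-flow ODE transports the marginals of the forward process. -/
theorem map_flow_forwardLaw {φ : ℝ → ℝ → E d → E d} (hφ : IsFlow (drift p) φ) {s t : ℝ}
    (hs : 0 < s) (ht : 0 < t) : (forwardLaw p s).map (φ s t) = forwardLaw p t := by
  have hcont := hφ.continuous (isTameField_drift p) hs ht
  refine measure_ext_of_lipschitz fun w L R hw hw1 hw0 => ?_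
  have hd : ∀ r ∈ Ioi (0 : ℝ), HasDerivAt (fun r => ∫ ω : E d × E d, w (φ r t (ω.1 + r • ω.2))
      ∂(p.prod (stdGaussian (E d)))) 0 r := fun r hr =>
    hasDerivAt_integral_flow p hφ hr ht hw hw1 hw0
  -- The function of `r` is constant on `(0, ∞)`. At `r = s` it integrates `w` against the
  -- pushforward; at `r = t` the flow is the identity.
  have h := isOpen_Ioi.is_const_of_deriv_eq_zero isPreconnected_Ioi
    (fun r hr => (hd r hr).differentiableAt.differentiableWithinAt)
    (fun r hr => (hd r hr).deriv) (mem_Ioi.2 hs) (mem_Ioi.2 ht)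
  have hwφ : Continuous fun x => w (φ s t x) := hw.continuous.comp hcont
  rw [integral_map hcont.aemeasurable hw.continuous.aestronglyMeasurable, forwardLaw_eq_map,
    forwardLaw_eq_map, integral_map (by fun_prop)
      hwφ.aestronglyMeasurable,
    integral_map (by fun_prop) hw.continuous.aestronglyMeasurable]
  refine h.trans (integral_congr_ae (ae_of_all _ fun ω => ?_))
  simp only [hφ.self t _ ht]

end Pushforward

/-! ### Trajectories down to time zero and the noise-to-data map. -/

section Trajectory

variable {d : ℕ} (p : Measure (E d)) [IsProbabilityMeasure p]

/-- Trajectories in terms of the drift. -/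
theorem isTrajectory_iff {T : ℝ} (hT : 0 < T) {y : E d} {x : ℝ → E d} :
    IsTrajectory p T y x ↔ IntervalIntegrable (fun τ => drift p τ (x τ)) volume T 0 ∧
      ∀ t ∈ Icc (0 : ℝ) T, x t = y + ∫ τ in T..t, drift p τ (x τ) := by
  have hpos : ∀ t ∈ Icc (0 : ℝ) T, ∀ τ ∈ uIoc T t, 0 < τ := by
    intro t ht τ hτ
    rw [uIoc_of_ge ht.2] at hτ
    exact ht.1.trans_lt hτ.1
  have h1 : IntervalIntegrable (fun τ => τ • score p τ (x τ)) volume T 0 ↔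
      IntervalIntegrable (fun τ => drift p τ (x τ)) volume T 0 := by
    have hneg : IntervalIntegrable (fun τ => drift p τ (x τ)) volume T 0 ↔
        IntervalIntegrable (fun τ => -drift p τ (x τ)) volume T 0 :=
      ⟨fun h => h.neg, fun h => by simpa only [Pi.neg_def, neg_neg] using h.neg⟩
    rw [hneg]
    refine intervalIntegrable_congr fun τ hτ => ?_
    exact smul_score p (hpos 0 ⟨le_rfl, hT.le⟩ τ hτ) _
  have h2 : ∀ t ∈ Icc (0 : ℝ) T, ∫ τ in T..t, τ • score p τ (x τ) =
      -∫ τ in T..t, drift p τ (x τ) := by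
    intro t ht
    rw [← intervalIntegral.integral_neg]
    exact intervalIntegral.integral_congr_ae
      (ae_of_all _ fun τ hτ => smul_score p (hpos t ht τ hτ) _)
  constructor
  · rintro ⟨hi, he⟩
    exact ⟨h1.1 hi, fun t ht => by rw [he t ht, h2 t ht, sub_neg_eq_add]⟩
  · rintro ⟨hi, he⟩
    exact ⟨h1.2 hi, fun t ht => by rw [he t ht, h2 t ht, sub_neg_eq_add]⟩

/-- The curve that follows the flow `φ` of the drift backwards from `y` at time `T`, continued
to time `0`. -/
noncomputable def path (φ : ℝ → ℝ → E d → E d) (T : ℝ) (y : E d) (t : ℝ) : E d :=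
  y + ∫ τ in T..t, drift p τ (φ T τ y)

variable {p} {φ : ℝ → ℝ → E d → E d} (hφ : IsFlow (drift p) φ) {T : ℝ} (hT : 0 < T)

include hφ hT

theorem path_of_pos {t : ℝ} (ht : 0 < t) (y : E d) : path p φ T y t = φ T t y := by
  have hsub : ∀ τ ∈ uIcc T t, 0 < τ := fun τ hτ => (lt_min hT ht).trans_le hτ.1
  have hcont : ContinuousOn (fun τ => drift p τ (φ T τ y)) (uIcc T t) := by
    refine (isTameField_drift p).continuousOn.comp (f := fun τ => (τ, φ T τ y))
      (continuousOn_id.prodMk fun τ hτ =>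
        (hφ.hasDerivAt T y hT τ (hsub τ hτ)).continuousAt.continuousWithinAt)
      fun τ hτ => ⟨hsub τ hτ, mem_univ _⟩
  rw [path, intervalIntegral.integral_eq_sub_of_hasDerivAt
    (fun τ hτ => hφ.hasDerivAt T y hT τ (hsub τ hτ)) hcont.intervalIntegrable,
    hφ.self T y hT, add_sub_cancel]

theorem isTrajectory_path {y : E d}
    (hy : IntervalIntegrable (fun τ => drift p τ (φ T τ y)) volume T 0) :
    IsTrajectory p T y (path p φ T y) := by
  have hpos : ∀ t ∈ Icc (0 : ℝ) T, ∀ τ ∈ uIoc T t, 0 < τ := by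
    intro t ht τ hτ
    rw [uIoc_of_ge ht.2] at hτ
    exact ht.1.trans_lt hτ.1
  rw [isTrajectory_iff p hT]
  refine ⟨(intervalIntegrable_congr fun τ hτ => ?_).2 hy, fun t ht => ?_⟩
  · simp only [path_of_pos hφ hT (hpos 0 ⟨le_rfl, hT.le⟩ τ hτ)]
  · rw [path]
    congr 1
    exact intervalIntegral.integral_congr_ae
      (ae_of_all _ fun τ hτ => by rw [path_of_pos hφ hT (hpos t ht τ hτ)])

/-- Every trajectory follows the flow. -/
theorem IsTrajectory.eqOn_path {y : E d} {x : ℝ → E d} (hx : IsTrajectory p T y x) :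
    EqOn x (path p φ T y) (Icc 0 T) := by
  rw [isTrajectory_iff p hT] at hx
  obtain ⟨hi, he⟩ := hx
  have hcont : ContinuousOn x (Icc 0 T) := by
    have h := (intervalIntegral.continuousOn_primitive_interval' hi left_mem_uIcc).const_add y
    rw [uIcc_of_ge hT.le] at h
    exact h.congr he
  -- Away from time `0` the integral equation can be differentiated and ODE uniqueness applies. Time
  -- `0` follows because both curves integrate the same velocity over `(0, T]`.
  have hpos : ∀ t ∈ Ioc (0 : ℝ) T, x t = φ T t y := by
    intro t ht
    have hsub : Icc t T ⊆ Icc 0 T := Icc_subset_Icc_left ht.1.le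
    have hTm : T ∈ Icc t T := ⟨ht.2, le_rfl⟩
    have hd : ∀ r ∈ Icc t T, HasDerivWithinAt x (drift p r (x r)) (Icc t T) r := by
      intro r hr
      have h := ODE.hasDerivWithinAt_picard_Icc (f := drift p) (u := univ) (α := x) hTm
        ((isTameField_drift p).continuousOn.mono
          (prod_mono (fun r hr => ht.1.trans_le hr.1) subset_rfl))
        (hcont.mono hsub) (fun _ _ => mem_univ _) y hr
      exact h.congr_of_mem (fun q hq => by rw [ODE.picard_apply, he q (hsub hq)]) hr
    refine (isTameField_drift p).eqOn_Icc ht.1 hTm hd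
      (hφ.hasDerivWithinAt ht.1 hT y) ?_ ⟨le_rfl, ht.2⟩
    rw [he T ⟨hT.le, le_rfl⟩, intervalIntegral.integral_same, add_zero, hφ.self T y hT]
  intro t ht
  rw [he t ht, path]
  congr 1
  refine intervalIntegral.integral_congr_ae (ae_of_all _ fun τ hτ => ?_)
  rw [uIoc_of_ge ht.2] at hτ
  rw [hpos τ ⟨ht.1.trans_lt hτ.1, hτ.2⟩]

/-- Uniqueness of trajectories makes the choice inside `noiseToData` immaterial. -/
theorem noiseToData_eq_path {y : E d}
    (hy : IntervalIntegrable (fun τ => drift p τ (φ T τ y)) volume T 0) :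
    noiseToData p T y = path p φ T y 0 := by
  have hex : ∃ x : ℝ → E d, IsTrajectory p T y x := ⟨_, isTrajectory_path hφ hT hy⟩
  have h0 : (0 : ℝ) ∈ Icc 0 T := ⟨le_rfl, hT.le⟩
  rw [noiseToData, dif_pos hex, ← hex.choose_spec.eq 0 h0]
  exact hex.choose_spec.eqOn_path hφ hT h0

omit hφ hT in
/-- The fourth power of the speed, integrated along the trajectory from `y`. -/
noncomputable def energy (p : Measure (E d)) (φ : ℝ → ℝ → E d → E d) (T : ℝ) (y : E d) : ℝ≥0∞ :=
  ∫⁻ t in Ioc 0 T, ‖drift p t (φ T t y)‖ₑ ^ 4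

/-- In logarithmic time the flow is continuous in time on the whole line and measurable in space,
hence jointly measurable; values of `H` at nonpositive times are irrelevant. -/
theorem exists_measurable_flow :
    ∃ H : ℝ × E d → E d, Measurable H ∧ ∀ t, 0 < t → ∀ y, H (t, y) = φ T t y := by
  have h := measurable_uncurry_of_continuous_of_measurable
    (u := fun (r : ℝ) (y : E d) => φ T (Real.exp r) y)
    (fun y => continuous_iff_continuousAt.2 fun r =>
      ((hφ.hasDerivAt T y hT _ (Real.exp_pos r)).continuousAt).comp
        Real.continuous_exp.continuousAt)
    (fun r => (hφ.continuous (isTameField_drift p) hT (Real.exp_pos r)).measurable)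
  refine ⟨fun z => φ T (Real.exp (Real.log z.1)) z.2,
    h.comp ((Real.measurable_log.comp measurable_fst).prodMk measurable_snd),
    fun t ht y => ?_⟩
  simp only [Real.exp_log ht]

theorem measurable_energy : Measurable (energy p φ T) := by
  obtain ⟨H, hH, hHφ⟩ := exists_measurable_flow hφ hT
  have h : Measurable fun z : E d × ℝ => ‖drift p z.2 (H (z.2, z.1))‖ₑ ^ 4 :=
    (((measurable_drift p).comp (measurable_snd.prodMk (hH.comp measurable_swap))).enorm).pow_const 4
  have h2 := h.lintegral_prod_right' (ν := volume.restrict (Ioc 0 T))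
  convert h2 using 1
  funext y
  refine setLIntegral_congr_fun measurableSet_Ioc fun t ht => ?_
  simp only [hHφ t ht.1]

/-- After Tonelli, `φ T t y` has law `p_t` when `y` has law `p_T`, so each time slice is bounded by
the fourth moment of the noise. -/
theorem lintegral_energy_le :
    ∫⁻ y, energy p φ T y ∂(forwardLaw p T) ≤
      (∫⁻ z, ‖z‖ₑ ^ 4 ∂(stdGaussian (E d))) * ENNReal.ofReal T := by
  obtain ⟨H, hH, hHφ⟩ := exists_measurable_flow hφ hT
  have h : Measurable fun z : E d × ℝ => ‖drift p z.2 (H (z.2, z.1))‖ₑ ^ 4 :=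
    (((measurable_drift p).comp (measurable_snd.prodMk (hH.comp measurable_swap))).enorm).pow_const 4
  have h1 : ∀ y, energy p φ T y = ∫⁻ t in Ioc 0 T, ‖drift p t (H (t, y))‖ₑ ^ 4 := fun y =>
    setLIntegral_congr_fun measurableSet_Ioc fun t ht => by simp only [hHφ t ht.1]
  simp_rw [h1]
  rw [lintegral_lintegral_swap h.aemeasurable]
  calc ∫⁻ t in Ioc 0 T, ∫⁻ y, ‖drift p t (H (t, y))‖ₑ ^ 4 ∂(forwardLaw p T)
      ≤ ∫⁻ _t in Ioc 0 T, ∫⁻ z, ‖z‖ₑ ^ 4 ∂(stdGaussian (E d)) := by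
        refine setLIntegral_mono measurable_const fun t ht => ?_
        simp_rw [hHφ t ht.1]
        refine le_trans (le_of_eq ?_) (lintegral_drift_pow_four_le p ht.1)
        rw [← map_flow_forwardLaw p hφ hT ht.1,
          lintegral_map ((measurable_drift_apply p t).enorm.pow_const 4)
            (hφ.continuous (isTameField_drift p) hT ht.1).measurable]
    _ = _ := by rw [setLIntegral_const, Real.volume_Ioc, sub_zero]

theorem lintegral_energy_lt_top : ∫⁻ y, energy p φ T y ∂(forwardLaw p T) < ∞ :=
  (lintegral_energy_le hφ hT).trans_lt
    (ENNReal.mul_lt_top lintegral_enorm_pow_four_stdGaussian_lt_top ENNReal.ofReal_lt_top)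

theorem lintegral_speed_pow_four_le (y : E d) :
    (∫⁻ t in Ioc 0 T, ‖drift p t (φ T t y)‖ₑ) ^ 4 ≤ ENNReal.ofReal T ^ 3 * energy p φ T y ∧
      AEStronglyMeasurable (fun t => drift p t (φ T t y)) (volume.restrict (Ioc 0 T)) := by
  obtain ⟨H, hH, hHφ⟩ := exists_measurable_flow hφ hT
  have hpm : Measurable fun t : ℝ => (t, H (t, y)) :=
    measurable_id.prodMk (hH.comp measurable_prodMk_right)
  have h0 : Measurable fun t : ℝ => drift p t (H (t, y)) := by
    have := (measurable_drift p).comp hpm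
    exact this
  have hm : AEStronglyMeasurable (fun t => drift p t (φ T t y)) (volume.restrict (Ioc 0 T)) := by
    refine h0.aestronglyMeasurable.congr ?_
    filter_upwards [ae_restrict_mem measurableSet_Ioc] with t ht
    rw [hHφ t ht.1]
  refine ⟨?_, hm⟩
  have h := lintegral_pow_four_le (volume.restrict (Ioc 0 T)) hm.enorm
  rwa [Measure.restrict_apply_univ, Real.volume_Ioc, sub_zero] at h

theorem intervalIntegrable_of_energy {y : E d} (hy : energy p φ T y < ∞) :
    IntervalIntegrable (fun τ => drift p τ (φ T τ y)) volume T 0 := by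
  obtain ⟨hle, hm⟩ := lintegral_speed_pow_four_le hφ hT y
  refine IntervalIntegrable.symm ((intervalIntegrable_iff_integrableOn_Ioc_of_le hT.le).2 ⟨hm, ?_⟩)
  have h : (∫⁻ t in Ioc 0 T, ‖drift p t (φ T t y)‖ₑ) ^ 4 < ∞ :=
    hle.trans_lt (ENNReal.mul_lt_top (ENNReal.pow_lt_top ENNReal.ofReal_lt_top) hy)
  exact (ENNReal.pow_lt_top_iff.1 h).resolve_right (by norm_num)

theorem enorm_path_sub_pow_four_le (y : E d) :
    ‖path p φ T y 0 - y‖ₑ ^ 4 ≤ ENNReal.ofReal T ^ 3 * energy p φ T y := by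
  refine le_trans ?_ (lintegral_speed_pow_four_le hφ hT y).1
  gcongr
  rw [path, add_sub_cancel_left, intervalIntegral.integral_of_ge hT.le, enorm_neg]
  exact enorm_integral_le_lintegral_enorm _

theorem ae_energy_lt_top : ∀ᵐ y ∂(forwardLaw p T), energy p φ T y < ∞ :=
  ae_lt_top (measurable_energy hφ hT) (lintegral_energy_lt_top hφ hT).ne

/-- Measurability and the pushforward identity for the noise-to-data map are obtained by passing to
this limit. -/
theorem tendsto_flow_noiseToData {y : E d} (hy : energy p φ T y < ∞) :
    Tendsto (fun n : ℕ => φ T (T / ((n : ℝ) + 1)) y) atTop (𝓝 (noiseToData p T y)) := by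
  have hi := intervalIntegrable_of_energy hφ hT hy
  rw [noiseToData_eq_path hφ hT hi]
  have hcont : ContinuousOn (path p φ T y) (Icc 0 T) := by
    have h := (intervalIntegral.continuousOn_primitive_interval' hi left_mem_uIcc).const_add y
    rwa [uIcc_of_ge hT.le] at h
  have hlim : Tendsto (fun n : ℕ => T / ((n : ℝ) + 1)) atTop (𝓝[Icc 0 T] 0) := by
    refine tendsto_nhdsWithin_iff.2 ⟨?_, Eventually.of_forall fun n => ⟨by positivity, ?_⟩⟩
    · have := (tendsto_one_div_add_atTop_nhds_zero_nat (𝕜 := ℝ)).const_mul T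
      simpa [div_eq_mul_inv] using this
    · exact div_le_self hT.le (by linarith [n.cast_nonneg (α := ℝ)])
  refine ((hcont 0 ⟨le_rfl, hT.le⟩).tendsto.comp hlim).congr fun n => ?_
  exact path_of_pos hφ hT (by positivity) y

theorem aemeasurable_noiseToData_forwardLaw_of_isFlow :
    AEMeasurable (noiseToData p T) (forwardLaw p T) := by
  refine aemeasurable_of_tendsto_metrizable_ae atTop
    (f := fun (n : ℕ) y => φ T (T / ((n : ℝ) + 1)) y) (fun n => ?_) ?_
  · exact (hφ.continuous (isTameField_drift p) hT (by positivity)).aemeasurable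
  · filter_upwards [ae_energy_lt_top hφ hT] with y hy
    exact tendsto_flow_noiseToData hφ hT hy

omit hφ in
theorem aemeasurable_noiseToData_forwardLaw : AEMeasurable (noiseToData p T) (forwardLaw p T) := by
  obtain ⟨φ, hφ⟩ := (isTameField_drift p).exists_isFlow
  exact aemeasurable_noiseToData_forwardLaw_of_isFlow hφ hT

omit hφ in
variable (p) in
/-- The noise-to-data map transports the law at time `T` to the data. -/
theorem map_noiseToData_forwardLaw : (forwardLaw p T).map (noiseToData p T) = p := by
  obtain ⟨φ, hφ⟩ := (isTameField_drift p).exists_isFlow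
  have hm := aemeasurable_noiseToData_forwardLaw (p := p) hT
  have : IsProbabilityMeasure ((forwardLaw p T).map (noiseToData p T)) :=
    Measure.isProbabilityMeasure_map hm
  refine measure_ext_of_lipschitz fun w L R hw hw1 _ => ?_
  rw [integral_map hm hw.continuous.aestronglyMeasurable]
  have hpos : ∀ n : ℕ, 0 < T / ((n : ℝ) + 1) := fun n => by positivity
  have h1 : Tendsto (fun n : ℕ => ∫ y, w (φ T (T / ((n : ℝ) + 1)) y) ∂(forwardLaw p T)) atTop
      (𝓝 (∫ y, w (noiseToData p T y) ∂(forwardLaw p T))) := by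
    refine tendsto_integral_of_dominated_convergence (fun _ => 1) (fun n => ?_)
      (integrable_const _) (fun n => ae_of_all _ fun y => hw1 _) ?_
    · exact (hw.continuous.comp
        (hφ.continuous (isTameField_drift p) hT (hpos n))).aestronglyMeasurable
    · filter_upwards [ae_energy_lt_top hφ hT] with y hy
      exact (hw.continuous.tendsto _).comp (tendsto_flow_noiseToData hφ hT hy)
  have h2 : Tendsto (fun n : ℕ => ∫ ω : E d × E d, w (ω.1 + (T / ((n : ℝ) + 1)) • ω.2)
      ∂(p.prod (stdGaussian (E d)))) atTop
      (𝓝 (∫ ω : E d × E d, w ω.1 ∂(p.prod (stdGaussian (E d))))) := by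
    refine tendsto_integral_of_dominated_convergence (fun _ => 1) (fun n => ?_)
      (integrable_const _) (fun n => ae_of_all _ fun y => hw1 _) (ae_of_all _ fun ω => ?_)
    · exact (hw.continuous.comp (by fun_prop)).aestronglyMeasurable
    · have hlim : Tendsto (fun n : ℕ => T / ((n : ℝ) + 1)) atTop (𝓝 0) := by
        have := (tendsto_one_div_add_atTop_nhds_zero_nat (𝕜 := ℝ)).const_mul T
        simpa [div_eq_mul_inv] using this
      have := (hlim.smul_const ω.2).const_add ω.1
      rw [zero_smul, add_zero] at this
      exact (hw.continuous.tendsto _).comp this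
  -- Both sides integrate `w` against the forward law at time `T / (n + 1)`: the flow side tends to
  -- the law of `Φ_p`, the coupling side to `p`.
  have h3 : ∀ n : ℕ, ∫ y, w (φ T (T / ((n : ℝ) + 1)) y) ∂(forwardLaw p T) =
      ∫ ω : E d × E d, w (ω.1 + (T / ((n : ℝ) + 1)) • ω.2) ∂(p.prod (stdGaussian (E d))) := by
    intro n
    have hc := hφ.continuous (isTameField_drift p) hT (hpos n)
    rw [← integral_map (φ := φ T (T / ((n : ℝ) + 1))) hc.aemeasurable
        hw.continuous.aestronglyMeasurable,
      map_flow_forwardLaw p hφ hT (hpos n), forwardLaw_eq_map,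
      integral_map (by fun_prop) hw.continuous.aestronglyMeasurable]
  simp_rw [h3] at h1
  rw [tendsto_nhds_unique h1 h2, integral_fun_fst]
  simp

omit hφ in
variable (p) in
theorem lintegral_noiseToData_sub_pow_four_lt_top :
    ∫⁻ y, ‖noiseToData p T y - y‖ₑ ^ 4 ∂(forwardLaw p T) < ∞ := by
  obtain ⟨φ, hφ⟩ := (isTameField_drift p).exists_isFlow
  refine lt_of_le_of_lt (lintegral_mono_ae (g := fun y => ENNReal.ofReal T ^ 3 * energy p φ T y) ?_)
    ?_
  · filter_upwards [ae_energy_lt_top hφ hT] with y hy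
    rw [noiseToData_eq_path hφ hT (intervalIntegrable_of_energy hφ hT hy)]
    exact enorm_path_sub_pow_four_le hφ hT y
  · rw [lintegral_const_mul _ (measurable_energy hφ hT)]
    exact ENNReal.mul_lt_top (ENNReal.pow_lt_top ENNReal.ofReal_lt_top)
      (lintegral_energy_lt_top hφ hT)

end Trajectory

/-! ### Change of measure to the noise, and the metric axioms. -/

section Metric

variable {d : ℕ}

section

variable (p : Measure (E d)) [IsProbabilityMeasure p] {T : ℝ}

theorem measurable_mass (hT : 0 < T) : Measurable (mass p T) :=
  (continuous_iff_continuousAt.2 fun x => (hasFDerivAt_mass p hT x).continuousAt).measurable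

theorem measurable_density_ratio (hT : 0 < T) :
    Measurable fun x => ENNReal.ofReal (bump (T⁻¹ • x) / mass p T x) := by
  have hbump : Measurable fun x : E d => bump (T⁻¹ • x) :=
    continuous_bump.measurable.comp (by fun_prop)
  exact (hbump.div (measurable_mass p hT)).ennreal_ofReal

theorem noise_eq_forwardLaw_withDensity (hT : 0 < T) : noise d T = (forwardLaw p T).withDensity
    (fun x => ENNReal.ofReal (bump (T⁻¹ • x) / mass p T x)) := by
  have hmass := measurable_mass p hT
  have hf : Measurable fun x => ENNReal.ofReal (forwardDensity p T x) := by
    simp_rw [forwardDensity_eq p hT]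
    exact (hmass.const_mul _).ennreal_ofReal
  rw [forwardLaw_eq_withDensity p hT, noise_eq_withDensity d hT,
    ← withDensity_mul _ hf (measurable_density_ratio p hT)]
  congr 1
  funext x
  have hc := normConst_pos (d := d) hT
  have hm := mass_pos p hT x
  rw [Pi.mul_apply, forwardDensity_eq p hT, noiseDensity_eq hT,
    ← ENNReal.ofReal_mul (mul_pos hc hm).le]
  congr 1
  field_simp

/-- This is the integral of the squared ratio against `p_T`. By `half_exp_le_mass` the ratio at `T •
z` is at most exponential in `‖z‖`, hence dominated by a multiple of `exp (C ‖z‖²)`, which is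
integrable for some `C > 0` by Fernique's theorem. -/
theorem lintegral_density_ratio_lt_top (hT : 0 < T) :
    ∫⁻ x, ENNReal.ofReal (bump (T⁻¹ • x) / mass p T x) ∂(noise d T) < ∞ := by
  obtain ⟨R, hR0, hR⟩ := exists_half_le_closedBall p
  obtain ⟨C, hC, hint⟩ := IsGaussian.exists_integrable_exp_sq (stdGaussian (E d))
  rw [noise, lintegral_map (measurable_density_ratio p hT) (by fun_prop)]
  set A : ℝ := 2 * Real.exp (R ^ 2 / (2 * T ^ 2) + (R / T) ^ 2 / (4 * C)) with hA
  have hint2 := hint.const_mul A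
  refine lt_of_le_of_lt (lintegral_mono fun z => ?_) hint2.lintegral_lt_top
  refine ENNReal.ofReal_le_ofReal ?_
  rw [div_le_iff₀ (mass_pos p hT _)]
  have h1 := half_exp_le_mass p hR hT (T • z)
  rw [norm_smul, Real.norm_of_nonneg hT.le] at h1
  rw [inv_smul_smul₀ hT.ne', bump]
  have h2 : Real.exp (-(‖z‖ ^ 2 / 2)) ≤ A * Real.exp (C * ‖z‖ ^ 2) *
      (1 / 2 * Real.exp (-(((T * ‖z‖ + R) / T) ^ 2 / 2))) := by
    have h3 : A * Real.exp (C * ‖z‖ ^ 2) *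
        (1 / 2 * Real.exp (-(((T * ‖z‖ + R) / T) ^ 2 / 2))) =
        Real.exp ((R ^ 2 / (2 * T ^ 2) + (R / T) ^ 2 / (4 * C)) + C * ‖z‖ ^ 2 +
          -(((T * ‖z‖ + R) / T) ^ 2 / 2)) := by
      rw [hA, Real.exp_add _ (-(((T * ‖z‖ + R) / T) ^ 2 / 2)), Real.exp_add _ (C * ‖z‖ ^ 2)]
      ring
    rw [h3, Real.exp_le_exp]
    have h4 : (T * ‖z‖ + R) / T = ‖z‖ + R / T := by field_simp
    have h5 : R ^ 2 / (2 * T ^ 2) = (R / T) ^ 2 / 2 := by field_simp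
    -- Completing the square absorbs the cross term `(R / T) ‖z‖`; this explains the second summand
    -- in the exponent of `A`.
    have h6 : (R / T) ^ 2 / (4 * C) + C * ‖z‖ ^ 2 - (R / T) * ‖z‖ =
        (R / T - 2 * C * ‖z‖) ^ 2 / (4 * C) := by
      field_simp
      ring
    have h7 : 0 ≤ (R / T - 2 * C * ‖z‖) ^ 2 / (4 * C) := by positivity
    rw [h4, h5]
    nlinarith
  exact h2.trans (mul_le_mul_of_nonneg_left h1 (by positivity))

theorem volume_absolutelyContinuous_forwardLaw (hT : 0 < T) :
    (volume : Measure (E d)) ≪ forwardLaw p T := by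
  refine (volume_absolutelyContinuous_noise hT).trans ?_
  rw [noise_eq_forwardLaw_withDensity p hT]
  exact withDensity_absolutelyContinuous _ _

theorem noise_absolutelyContinuous_forwardLaw (hT : 0 < T) : noise d T ≪ forwardLaw p T := by
  rw [noise_eq_forwardLaw_withDensity p hT]
  exact withDensity_absolutelyContinuous _ _

/-- Against `p_T` the integrand is `ρ ‖Φ_p(y) - y‖²`, at most `ρ² + ‖Φ_p(y) - y‖⁴`. This is why
fourth moments are carried along. -/
theorem memLp_noiseToData_sub (hT : 0 < T) :
    MemLp (fun y => noiseToData p T y - y) 2 (noise d T) := by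
  set ρ : E d → ℝ≥0∞ := fun x => ENNReal.ofReal (bump (T⁻¹ • x) / mass p T x)
  have hρm : Measurable ρ := measurable_density_ratio p hT
  have hdens : noise d T = (forwardLaw p T).withDensity ρ := noise_eq_forwardLaw_withDensity p hT
  have hm : AEMeasurable (fun y => noiseToData p T y - y) (forwardLaw p T) :=
    (aemeasurable_noiseToData_forwardLaw hT).sub aemeasurable_id
  have hm' := hm.mono_ac (noise_absolutelyContinuous_forwardLaw p hT)
  refine ⟨hm'.aestronglyMeasurable, ?_⟩
  rw [eLpNorm_lt_top_iff_lintegral_rpow_enorm_lt_top (by norm_num) (by norm_num)]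
  have h2 : ((2 : ℝ≥0∞).toReal) = ((2 : ℕ) : ℝ) := by norm_num
  simp_rw [h2, ENNReal.rpow_natCast]
  rw [hdens, lintegral_withDensity_eq_lintegral_mul₀ hρm.aemeasurable
    (hm.enorm.pow_const 2)]
  have hsq : ∫⁻ x, ρ x * ρ x ∂(forwardLaw p T) < ∞ := by
    have h := lintegral_density_ratio_lt_top p hT
    rw [hdens] at h
    change ∫⁻ x, ρ x ∂_ < ∞ at h
    rwa [lintegral_withDensity_eq_lintegral_mul _ hρm hρm] at h
  refine lt_of_le_of_lt (lintegral_mono (g := fun x => ρ x * ρ x + ‖noiseToData p T x - x‖ₑ ^ 4)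
    fun x => ?_) ?_
  · simp only [Pi.mul_apply]
    rcases le_total (ρ x) (‖noiseToData p T x - x‖ₑ ^ 2) with h | h
    · calc ρ x * ‖noiseToData p T x - x‖ₑ ^ 2
          ≤ ‖noiseToData p T x - x‖ₑ ^ 2 * ‖noiseToData p T x - x‖ₑ ^ 2 := by gcongr
        _ = ‖noiseToData p T x - x‖ₑ ^ 4 := by ring
        _ ≤ _ := le_add_self
    · calc ρ x * ‖noiseToData p T x - x‖ₑ ^ 2 ≤ ρ x * ρ x := by gcongr
        _ ≤ _ := le_self_add
  · have hρρ : Measurable fun x => ρ x * ρ x := hρm.mul hρm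
    rw [lintegral_add_left hρρ]
    exact ENNReal.add_lt_top.2 ⟨hsq, lintegral_noiseToData_sub_pow_four_lt_top p hT⟩

theorem memLp_noiseToData_sub_noiseToData (q : Measure (E d)) [IsProbabilityMeasure q]
    (hT : 0 < T) : MemLp (fun y => noiseToData p T y - noiseToData q T y) 2 (noise d T) := by
  have h := (memLp_noiseToData_sub p hT).sub (memLp_noiseToData_sub q hT)
  refine h.ae_eq (ae_of_all _ fun y => ?_)
  simp only [Pi.sub_apply]
  abel

theorem ae_exists_isTrajectory (hT : 0 < T) :
    ∀ᵐ y ∂(noise d T), ∃ x : ℝ → E d, IsTrajectory p T y x := by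
  obtain ⟨φ, hφ⟩ := (isTameField_drift p).exists_isFlow
  filter_upwards [(noise_absolutelyContinuous_forwardLaw p hT).ae_le (ae_energy_lt_top hφ hT)]
    with y hy
  exact ⟨_, isTrajectory_path hφ hT (intervalIntegrable_of_energy hφ hT hy)⟩

theorem IsTrajectory.eqOn (hT : 0 < T) {y : E d} {x x' : ℝ → E d} (hx : IsTrajectory p T y x)
    (hx' : IsTrajectory p T y x') : EqOn x x' (Icc 0 T) := by
  obtain ⟨φ, hφ⟩ := (isTameField_drift p).exists_isFlow
  exact (hx.eqOn_path hφ hT).trans (hx'.eqOn_path hφ hT).symm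

end

/-- If the convolution misses `s`, some translate of `s` is null for the noise, as `b ≠ 0`; the
positive Gaussian density and translation invariance make `s` Lebesgue-null. -/
theorem volume_absolutelyContinuous_conv_noise {b : Measure (E d)} [SFinite b] (hb : b ≠ 0)
    {t : ℝ} (ht : 0 < t) : (volume : Measure (E d)) ≪ b ∗ noise d t := by
  refine Measure.AbsolutelyContinuous.mk fun s hs h0 => ?_
  rw [← lintegral_indicator_one hs, Measure.lintegral_conv (measurable_one.indicator hs),
    lintegral_eq_zero_iff (by
      exact Measurable.lintegral_prod_right' (f := fun z : E d × E d =>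
        s.indicator (1 : E d → ℝ≥0∞) (z.1 + z.2))
        ((measurable_one.indicator hs).comp (by fun_prop)))] at h0
  have : (ae b).NeBot := ae_neBot.2 hb
  obtain ⟨y, hy⟩ := h0.exists
  have h1 : ∀ z, s.indicator (1 : E d → ℝ≥0∞) (y + z) =
      ((fun z => y + z) ⁻¹' s).indicator 1 z := fun z => rfl
  simp_rw [h1] at hy
  rw [lintegral_indicator_one (measurable_const_add y hs), Pi.zero_apply] at hy
  have h2 := volume_absolutelyContinuous_noise ht hy
  rwa [measure_preimage_add] at h2

/-- The Markov chain `x ↦ Φ(x + T z)` with `z` standard Gaussian has at most one invariant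
probability measure. -/
theorem eq_of_map_conv_noise_eq {p q : Measure (E d)} [IsProbabilityMeasure p]
    [IsProbabilityMeasure q] {t : ℝ} (ht : 0 < t) {Φ : E d → E d} (hΦ : Measurable Φ)
    (hp : (p ∗ noise d t).map Φ = p) (hq : (q ∗ noise d t).map Φ = q) : p = q := by
  obtain ⟨s, hs, hsle, hsge⟩ := hahn_decomposition p q
  -- `a` and `b` are the positive and negative parts of `p - q`.
  set a := p.restrict s - q.restrict s
  set b := q.restrict sᶜ - p.restrict sᶜ
  have hle1 : q.restrict s ≤ p.restrict s := Measure.le_iff.2 fun u hu => by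
    rw [Measure.restrict_apply hu, Measure.restrict_apply hu]
    exact hsle _ (hu.inter hs) inter_subset_right
  have hle2 : p.restrict sᶜ ≤ q.restrict sᶜ := Measure.le_iff.2 fun u hu => by
    rw [Measure.restrict_apply hu, Measure.restrict_apply hu]
    exact hsge _ (hu.inter hs.compl) inter_subset_right
  have hap : a + q.restrict s = p.restrict s := Measure.sub_add_cancel_of_le hle1
  have hbq : b + p.restrict sᶜ = q.restrict sᶜ := Measure.sub_add_cancel_of_le hle2
  have hsum : p + b = q + a := by
    have h1 := Measure.restrict_add_restrict_compl (μ := p) hs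
    have h2 := Measure.restrict_add_restrict_compl (μ := q) hs
    calc p + b = p.restrict s + p.restrict sᶜ + b := by rw [h1]
      _ = (a + q.restrict s) + (b + p.restrict sᶜ) := by rw [hap]; abel
      _ = (q.restrict s + q.restrict sᶜ) + a := by rw [hbq]; abel
      _ = q + a := by rw [h2]
  have ha_fin : IsFiniteMeasure a := isFiniteMeasure_of_le _ Measure.sub_le
  have hb_fin : IsFiniteMeasure b := isFiniteMeasure_of_le _ Measure.sub_le
  by_cases hb0 : b = 0
  · have h0 : a univ = 0 := by
      have h := congrArg (fun μ : Measure (E d) => μ univ) hsum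
      simp only [hb0, add_zero, Measure.add_apply, measure_univ] at h
      rw [← add_zero (1 : ℝ≥0∞), add_assoc, zero_add] at h
      exact ((ENNReal.add_right_inj ENNReal.one_ne_top).1 h).symm
    rw [hb0, Measure.measure_univ_eq_zero.1 h0, add_zero, add_zero] at hsum
    exact hsum
  exfalso
  -- `B` is the event that the next step lands in `s`. Invariance yields `(a ∗ noise) B = a univ +
  -- (b ∗ noise) B`, while the left side is at most `a univ`. So `b ∗ noise` misses `B`, hence `B`
  -- is Lebesgue-null, hence `a ∗ noise` misses it too, and `a` and `b` have mass zero.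
  set B := Φ ⁻¹' s
  have hpB : (p ∗ noise d t) B = p s := by rw [← Measure.map_apply hΦ hs, hp]
  have hqB : (q ∗ noise d t) B = q s := by rw [← Measure.map_apply hΦ hs, hq]
  have hconv : p s + (b ∗ noise d t) B = q s + (a ∗ noise d t) B := by
    have h := congrArg (fun μ : Measure (E d) => (μ ∗ noise d t) B) hsum
    simp only [Measure.add_conv, Measure.add_apply] at h
    rwa [hpB, hqB] at h
  have has : a univ + q s = p s := by
    have h := congrArg (fun μ : Measure (E d) => μ univ) hap
    simpa using h
  have hab : a univ = b univ := by
    have h := congrArg (fun μ : Measure (E d) => μ univ) hsum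
    simp only [Measure.add_apply, measure_univ] at h
    exact ((ENNReal.add_right_inj ENNReal.one_ne_top).1 h).symm
  have hle : (a ∗ noise d t) B ≤ a univ := by
    refine (measure_mono (subset_univ B)).trans_eq ?_
    rw [Measure.conv, Measure.map_apply (by fun_prop) MeasurableSet.univ, preimage_univ,
      ← univ_prod_univ, Measure.prod_prod, measure_univ (μ := noise d t), mul_one]
  have hconv2 : a univ + (b ∗ noise d t) B = (a ∗ noise d t) B := by
    rw [← has, add_comm (a univ), add_assoc] at hconv
    exact (ENNReal.add_right_inj (measure_ne_top q s)).1 hconv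
  have hbB : (b ∗ noise d t) B = 0 := by
    have h : a univ + (b ∗ noise d t) B ≤ a univ + 0 := by rw [hconv2, add_zero]; exact hle
    exact le_antisymm ((ENNReal.add_le_add_iff_left (measure_ne_top a univ)).1 h) zero_le
  have hvol := volume_absolutelyContinuous_conv_noise hb0 ht hbB
  have haB : (a ∗ noise d t) B = 0 :=
    Measure.conv_absolutelyContinuous (noise_absolutelyContinuous_volume ht) hvol
  rw [haB, hbB, add_zero, hab] at hconv2
  exact hb0 (Measure.measure_univ_eq_zero.1 hconv2)

theorem pfd_id_eq_eLpNorm (p q : Measure (E d)) [IsProbabilityMeasure p] [IsProbabilityMeasure q]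
    {T : ℝ} (hT : 0 < T) : pfd id T p q =
      (eLpNorm (fun y => noiseToData p T y - noiseToData q T y) 2 (noise d T)).toReal := by
  have h := memLp_noiseToData_sub_noiseToData p q hT
  rw [h.eLpNorm_eq_integral_rpow_norm (by norm_num) (by norm_num), pfd,
    ENNReal.toReal_ofReal (by positivity), Real.sqrt_eq_rpow]
  simp

theorem pfd_id_eq_zero_iff (p q : Measure (E d)) [IsProbabilityMeasure p]
    [IsProbabilityMeasure q] {T : ℝ} (hT : 0 < T) : pfd id T p q = 0 ↔ p = q := by
  constructor
  · intro h
    have hL := memLp_noiseToData_sub_noiseToData p q hT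
    rw [pfd_id_eq_eLpNorm p q hT, ENNReal.toReal_eq_zero_iff, or_iff_left hL.eLpNorm_ne_top,
      eLpNorm_eq_zero_iff hL.1 (by norm_num)] at h
    -- Lebesgue measure mediates: it inherits the almost-everywhere equality from the noise and
    -- passes it to both forward laws, so one Borel map represents `Φ_p` and `Φ_q`.
    have hvol := (volume_absolutelyContinuous_noise hT).ae_le h
    have hpm := aemeasurable_noiseToData_forwardLaw (p := p) hT
    have hpvol := hpm.mono_ac (volume_absolutelyContinuous_forwardLaw p hT)
    have h1 : noiseToData p T =ᵐ[volume] hpvol.mk _ := hpvol.ae_eq_mk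
    have h2 : noiseToData q T =ᵐ[volume] hpvol.mk _ := by
      filter_upwards [hvol, h1] with y hy hy1
      rw [← hy1]
      exact (sub_eq_zero.1 hy).symm
    refine eq_of_map_conv_noise_eq hT hpvol.measurable_mk ?_ ?_
    · conv_rhs => rw [← map_noiseToData_forwardLaw p hT]
      exact (Measure.map_congr ((forwardLaw_absolutelyContinuous_volume p hT).ae_le h1)).symm
    · conv_rhs => rw [← map_noiseToData_forwardLaw q hT]
      exact (Measure.map_congr ((forwardLaw_absolutelyContinuous_volume q hT).ae_le h2)).symm
  · rintro rfl
    simp [pfd]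

theorem pfd_id_triangle (p q r : Measure (E d)) [IsProbabilityMeasure p]
    [IsProbabilityMeasure q] [IsProbabilityMeasure r] {T : ℝ} (hT : 0 < T) :
    pfd id T p q ≤ pfd id T p r + pfd id T r q := by
  have h1 := memLp_noiseToData_sub_noiseToData p r hT
  have h2 := memLp_noiseToData_sub_noiseToData r q hT
  rw [pfd_id_eq_eLpNorm p q hT, pfd_id_eq_eLpNorm p r hT, pfd_id_eq_eLpNorm r q hT,
    ← ENNReal.toReal_add h1.eLpNorm_ne_top h2.eLpNorm_ne_top]
  refine ENNReal.toReal_mono (ENNReal.add_ne_top.2 ⟨h1.eLpNorm_ne_top, h2.eLpNorm_ne_top⟩) ?_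
  refine le_trans (le_of_eq ?_) (eLpNorm_add_le h1.1 h2.1 (by norm_num))
  congr 1
  funext y
  simp

theorem pfd_id_comm (p q : Measure (E d)) (T : ℝ) : pfd id T p q = pfd id T q p := by
  simp only [pfd, id, norm_sub_rev]

end Metric

end PFD

theorem theorem1 (d : ℕ) (T : ℝ) (hT : 0 < T) :
    -- the noise-to-data maps are well defined: trajectories are unique, and they exist
    -- for almost every initial noise
    (∀ (p : Measure (PFD.E d)) [IsProbabilityMeasure p],
      (∀ᵐ y ∂(PFD.noise d T), ∃ x : ℝ → PFD.E d, PFD.IsTrajectory p T y x) ∧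
      (∀ (y : PFD.E d) (x x' : ℝ → PFD.E d),
        PFD.IsTrajectory p T y x → PFD.IsTrajectory p T y x' → Set.EqOn x x' (Set.Icc 0 T))) ∧
    -- the expectation that defines the distance is finite
    (∀ (p q : Measure (PFD.E d)) [IsProbabilityMeasure p] [IsProbabilityMeasure q],
      Integrable (fun y => ‖PFD.noiseToData p T y - PFD.noiseToData q T y‖ ^ 2)
        (PFD.noise d T)) ∧
    -- positivity
    (∀ (p q : Measure (PFD.E d)) [IsProbabilityMeasure p] [IsProbabilityMeasure q],
      p ≠ q → 0 < PFD.pfd id T p q) ∧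
    -- identity of indiscernibles
    (∀ (p q : Measure (PFD.E d)) [IsProbabilityMeasure p] [IsProbabilityMeasure q],
      PFD.pfd id T p q = 0 ↔ p = q) ∧
    -- symmetry
    (∀ (p q : Measure (PFD.E d)) [IsProbabilityMeasure p] [IsProbabilityMeasure q],
      PFD.pfd id T p q = PFD.pfd id T q p) ∧
    -- triangle inequality
    (∀ (p q p' : Measure (PFD.E d)) [IsProbabilityMeasure p] [IsProbabilityMeasure q]
        [IsProbabilityMeasure p'],
      PFD.pfd id T p q ≤ PFD.pfd id T p p' + PFD.pfd id T p' q) := by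
  refine ⟨fun p _ => ⟨PFD.ae_exists_isTrajectory p hT, fun y x x' hx hx' => hx.eqOn p hT hx'⟩,
    fun p q _ _ => ?_, fun p q _ _ hpq => ?_, fun p q _ _ => PFD.pfd_id_eq_zero_iff p q hT,
    fun p q _ _ => PFD.pfd_id_comm p q T, fun p q p' _ _ _ => PFD.pfd_id_triangle p q p' hT⟩
  · have h := (PFD.memLp_noiseToData_sub_noiseToData p q hT).integrable_norm_pow (by norm_num)
    simpa using h
  · exact lt_of_le_of_ne (Real.sqrt_nonneg _)
      (fun h => hpq ((PFD.pfd_id_eq_zero_iff p q hT).1 h.symm))
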